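/- Let $M$ be an $n$-dimensional smooth ($C^\infty$) manifold. Let $\mathcal F^rM$ ($r=1,2$) be its bundle of $r$-frames, i.e. of $r$-jets at $0$ of inverses of charts of $M$. It is a principal bundle with group $\mathrm G^1_n=\mathrm{GL}(n,\mathbb R)$ for $r=1$, and $\mathrm G^2_n=\mathrm G^1_n\rtimes \mathrm S^2_n$ for $r=2$, where $\mathrm S^2_n$ is the additive group of symmetric bilinear maps $\mathbb R^n\times\mathbb R^n\to\mathbb R^n$, the product is $(a,s)(b,t)=(ab,\,b^{-1}s(b,b)+t)$, and $(a,s)$ stands for the 2-jet at $0$ of $u\mapsto a(u+\tfrac12 s(u,u))$. An $r$-th order $G$-structure on $M$ is a reduction of $\mathcal F^rM$ to a subgroup $G\subset \mathrm G^r_n$. A volume on $M$ is a first order $\mathrm{SL}^{\pm}_n$-structure, $\mathrm{SL}^\pm_n=\{a\in \mathrm G^1_n:|\det a|=1\}$. A symmetric linear connection (SLC) on $M$ is a second order $\mathrm G^1_n$-structure, $\mathrm G^1_n\simeq \mathrm G^1_n\rtimes 0$. A projective structure on $M$ is a second order $\mathrm G^1_n\rtimes\mathfrak p$-structure, where $\mathfrak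 p=\{s\in \mathrm S^2_n: s^i_{jk}=\delta^i_j\mu_k+\mu_j\delta^i_k,\ \mu\in\mathbb R^{n*}\}$. A 2-frame $z$ over the 1-frame $l$ is identified with a torsion-free transversal $n$-subspace $H_z\subset T_l\mathcal F^1M$: if $z$ is the 2-jet of the inverse of a chart, $H_z$ is the tangent space at $l$ of the field of coordinate frames of that chart. For a volume $V$, let $V^2$ be the set of 2-frames $z$ over points $l\in V$ with $H_z\subset T_lV$. An SLC $C$ makes $V$ parallel if every $z\in C$ lying over $V$ belongs to $V^2$ (the horizontal subspaces of $C$ at points of $V$ are tangent to $V$). **Theorem.** Let $Q\subset\mathcal F^2M$ be a projective structure and $V\subset\mathcal F^1M$ a volume on $M$. Then there is exactly one SLC $C$ on $M$ that belongs to $Q$ (that is, $C\subset Q$) and makes $V$ parallel. Moreover, $Q\cap V^2$ is a second order $\mathrm{SL}^\pm_n$-structure ($\mathrm{SL}^\pm_n\simeq\mathrm{SL}^\pm_n\rtimes 0$), and $C$ is its extension $(Q\cap V^2)\cdot \mathrm G^1_n$. -/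

import Mathlib

open scoped Manifold ContDiff Topology

noncomputable section

namespace HigherFrames

/-- The model space `ℝⁿ`. -/
abbrev Model (n : ℕ) : Type := EuclideanSpace ℝ (Fin n)

/-! ### The groups `G¹ₙ` and `G²ₙ` and some of their subgroups -/

/-- `G¹ₙ`, the general linear group of `ℝⁿ`. -/
abbrev G1 (n : ℕ) : Type := Model n ≃L[ℝ] Model n

/-- The additive group of symmetric bilinear maps `ℝⁿ × ℝⁿ → ℝⁿ`. -/
def symBilin (n : ℕ) : AddSubgroup (Model n →L[ℝ] Model n →L[ℝ] Model n) where
  carrier := {s | ∀ u v, s u v = s v u}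
  add_mem' := by
    intro s t hs ht u v
    simp [hs u v, ht u v]
  zero_mem' := by
    intro u v
    simp
  neg_mem' := by
    intro s hs u v
    simp [hs u v]

/-- `S²ₙ`, the symmetric bilinear maps `ℝⁿ × ℝⁿ → ℝⁿ`, as a type. -/
abbrev S2 (n : ℕ) : Type := symBilin n

instance (n : ℕ) : AddCommGroup (S2 n) := (symBilin n).toAddCommGroup

/-- The right action of `G¹ₙ` on `S²ₙ`: `(s, a) ↦ a⁻¹ s(a, a)`. -/
def S2.conj {n : ℕ} (s : S2 n) (a : G1 n) : S2 n :=
  ⟨(ContinuousLinearMap.compL ℝ (Model n) (Model n) (Model n)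
      (a.symm : Model n →L[ℝ] Model n)).comp
        ((s : Model n →L[ℝ] Model n →L[ℝ] Model n).bilinearComp
          (a : Model n →L[ℝ] Model n) (a : Model n →L[ℝ] Model n)), by
    intro u v
    simp [s.2 (a u) (a v)]⟩

@[simp] theorem S2.conj_apply {n : ℕ} (s : S2 n) (a : G1 n) (u v : Model n) :
    (S2.conj s a : Model n →L[ℝ] Model n →L[ℝ] Model n) u v =
      a.symm ((s : Model n →L[ℝ] Model n →L[ℝ] Model n) (a u) (a v)) := rfl

theorem S2.ext' {n : ℕ} {s t : S2 n}
    (h : ∀ u v, (s : Model n →L[ℝ] Model n →L[ℝ] Model n) u v =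
      (t : Model n →L[ℝ] Model n →L[ℝ] Model n) u v) : s = t :=
  Subtype.ext (ContinuousLinearMap.ext fun u => ContinuousLinearMap.ext fun v => h u v)

/-- `G²ₙ = G¹ₙ ⋊ S²ₙ`, the group of 2-jets at `0` of local diffeomorphisms of `ℝⁿ` fixing `0`.
The pair `(a, s)` stands for the 2-jet of `u ↦ a (u + s(u, u) / 2)`, the jet with first
derivative `a` and second derivative `a ∘ s`. -/
@[ext]
structure G2 (n : ℕ) : Type where
  lin : G1 n
  quad : S2 n

/-- The multiplication rule `(a, s)(b, t) = (ab, b⁻¹ s(b, b) + t)`, i.e. composition of jets. -/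
instance (n : ℕ) : Mul (G2 n) := ⟨fun g h => ⟨g.lin * h.lin, g.quad.conj h.lin + h.quad⟩⟩

instance (n : ℕ) : One (G2 n) := ⟨⟨1, 0⟩⟩

instance (n : ℕ) : Inv (G2 n) := ⟨fun g => ⟨g.lin⁻¹, -g.quad.conj g.lin⁻¹⟩⟩

@[simp] theorem G2.mul_lin {n : ℕ} (g h : G2 n) : (g * h).lin = g.lin * h.lin := rfl
@[simp] theorem G2.mul_quad {n : ℕ} (g h : G2 n) :
    (g * h).quad = g.quad.conj h.lin + h.quad := rfl
@[simp] theorem G2.one_lin {n : ℕ} : (1 : G2 n).lin = 1 := rfl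
@[simp] theorem G2.one_quad {n : ℕ} : (1 : G2 n).quad = 0 := rfl
@[simp] theorem G2.inv_lin {n : ℕ} (g : G2 n) : (g⁻¹).lin = g.lin⁻¹ := rfl
@[simp] theorem G2.inv_quad {n : ℕ} (g : G2 n) : (g⁻¹).quad = -g.quad.conj g.lin⁻¹ := rfl

theorem S2.conj_mul {n : ℕ} (s : S2 n) (a b : G1 n) : s.conj (a * b) = (s.conj a).conj b :=
  S2.ext' fun _ _ => rfl

theorem S2.conj_one {n : ℕ} (s : S2 n) : s.conj 1 = s := S2.ext' fun _ _ => rfl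

theorem S2.zero_conj {n : ℕ} (a : G1 n) : (0 : S2 n).conj a = 0 :=
  S2.ext' fun u v => by simp

theorem S2.add_conj {n : ℕ} (s t : S2 n) (a : G1 n) :
    (s + t).conj a = s.conj a + t.conj a :=
  S2.ext' fun u v => by simp

instance (n : ℕ) : Group (G2 n) :=
  Group.ofLeftAxioms
    (fun g h k => by
      ext1
      · simp [mul_assoc]
      · rw [G2.mul_quad, G2.mul_quad, G2.mul_quad, G2.mul_quad, G2.mul_lin, S2.add_conj,
          S2.conj_mul]
        exact add_assoc (G := S2 n) _ _ _)
    (fun g => by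
      ext1
      · simp
      · simp [S2.zero_conj])
    (fun g => by
      ext1
      · simp
      · have h : (-g.quad.conj g.lin⁻¹ : S2 n).conj g.lin = -g.quad := by
          have h1 := S2.add_conj (-g.quad.conj g.lin⁻¹) (g.quad.conj g.lin⁻¹) g.lin
          rw [neg_add_cancel, S2.zero_conj, ← S2.conj_mul, inv_mul_cancel, S2.conj_one] at h1
          exact eq_neg_of_add_eq_zero_left h1.symm
        simp [h])

/-- The subgroup `H ⋊ 𝔨` of `G²ₙ`, for a subgroup `H` of `G¹ₙ` and an `H`-invariant additive
subgroup `𝔨` of `S²ₙ`. -/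
def semidirect {n : ℕ} (H : Subgroup (G1 n)) (𝔨 : AddSubgroup (S2 n))
    (hinv : ∀ a ∈ H, ∀ s ∈ 𝔨, S2.conj s a ∈ 𝔨) : Subgroup (G2 n) where
  carrier := {g | g.lin ∈ H ∧ g.quad ∈ 𝔨}
  mul_mem' := fun {_ h} hg hh =>
    ⟨H.mul_mem hg.1 hh.1, 𝔨.add_mem (hinv h.lin hh.1 _ hg.2) hh.2⟩
  one_mem' := ⟨H.one_mem, 𝔨.zero_mem⟩
  inv_mem' := fun {_} hg =>
    ⟨H.inv_mem hg.1, 𝔨.neg_mem (hinv _ (H.inv_mem hg.1) _ hg.2)⟩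

/-- The subgroup `H ⋊ 0` of `G²ₙ`. -/
def linearSubgroup {n : ℕ} (H : Subgroup (G1 n)) : Subgroup (G2 n) :=
  semidirect H ⊥ (by
    intro a _ s hs
    rw [AddSubgroup.mem_bot] at hs ⊢
    rw [hs, S2.zero_conj])

/-- `SL^±ₙ`, the linear automorphisms with determinant `±1`. -/
def SLpm (n : ℕ) : Subgroup (G1 n) where
  carrier := {a | |(a : Model n →L[ℝ] Model n).det| = 1}
  mul_mem' := by
    intro a b ha hb
    have h : ((a * b : G1 n) : Model n →L[ℝ] Model n).det =
        (a : Model n →L[ℝ] Model n).det * (b : Model n →L[ℝ] Model n).det :=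
      LinearMap.det_comp (a : Model n →ₗ[ℝ] Model n) (b : Model n →ₗ[ℝ] Model n)
    simp only [Set.mem_ofPred_eq] at ha hb ⊢
    rw [h, abs_mul, ha, hb, one_mul]
  one_mem' := by
    have h : ((1 : G1 n) : Model n →L[ℝ] Model n).det = 1 :=
      LinearMap.det_id (A := ℝ) (M := Model n)
    simp only [Set.mem_ofPred_eq]
    rw [h, abs_one]
  inv_mem' := by
    intro a ha
    have h : ((a⁻¹ : G1 n) : Model n →L[ℝ] Model n).det * (a : Model n →L[ℝ] Model n).det = 1 := by
      have h1 := LinearMap.det_comp ((a⁻¹ : G1 n) : Model n →ₗ[ℝ] Model n)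
        (a : Model n →ₗ[ℝ] Model n)
      have h2 : ((a⁻¹ : G1 n) : Model n →ₗ[ℝ] Model n) ∘ₗ (a : Model n →ₗ[ℝ] Model n) =
          LinearMap.id := LinearMap.ext fun u => a.symm_apply_apply u
      rw [h2, LinearMap.det_id] at h1
      exact h1.symm
    simp only [Set.mem_ofPred_eq] at ha ⊢
    have h3 := congrArg abs h
    rwa [abs_mul, ha, mul_one, abs_one] at h3

/-- `𝔭 ⊆ S²ₙ`: the maps `s` with `s^i_{jk} = δ^i_j μ_k + μ_j δ^i_k` for a covector `μ`. -/
def projectivePart (n : ℕ) : AddSubgroup (S2 n) where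
  carrier := {s | ∃ μ : Model n →L[ℝ] ℝ, ∀ u v,
    (s : Model n →L[ℝ] Model n →L[ℝ] Model n) u v = μ v • u + μ u • v}
  add_mem' := by
    rintro s t ⟨μ, hμ⟩ ⟨ν, hν⟩
    refine ⟨μ + ν, fun u v => ?_⟩
    simp only [AddSubgroup.coe_add, add_apply, hμ, hν]
    module
  zero_mem' := ⟨0, fun u v => by simp⟩
  neg_mem' := by
    rintro s ⟨μ, hμ⟩
    refine ⟨-μ, fun u v => ?_⟩
    simp only [AddSubgroup.coe_neg, neg_apply, hμ]
    module

/-- The subgroup `G¹ₙ ⋊ 𝔭` of `G²ₙ`. -/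
def projectiveSubgroup (n : ℕ) : Subgroup (G2 n) :=
  semidirect ⊤ (projectivePart n) (by
    rintro a - s ⟨μ, hμ⟩
    refine ⟨μ.comp (a : Model n →L[ℝ] Model n), fun u v => ?_⟩
    simp [hμ])

/-! ### Frames of first and second order -/

section Frames

variable (n : ℕ) (M : Type*) [TopologicalSpace M] [ChartedSpace (Model n) M]

/-- A smooth chart of `M` whose image contains the origin of `ℝⁿ`. -/
structure CenteredChart where
  chart : OpenPartialHomeomorph M (Model n)
  mem_atlas : chart ∈ IsManifold.maximalAtlas (𝓡 n) ∞ M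
  zero_mem : (0 : Model n) ∈ chart.target

variable {n M}

/-- The point of `M` with coordinates `0`. -/
def CenteredChart.origin (c : CenteredChart n M) : M := c.chart.symm 0

/-- The inverses of the two charts have the same 1-jet at `0`. -/
def SameJet₁ (c d : CenteredChart n M) : Prop :=
  c.origin = d.origin ∧
    ∀ ψ ∈ IsManifold.maximalAtlas (𝓡 n) ∞ M, c.origin ∈ ψ.source →
      fderiv ℝ (ψ ∘ c.chart.symm) 0 = fderiv ℝ (ψ ∘ d.chart.symm) 0

/-- The inverses of the two charts have the same 2-jet at `0`. -/
def SameJet₂ (c d : CenteredChart n M) : Prop :=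
  SameJet₁ c d ∧
    ∀ ψ ∈ IsManifold.maximalAtlas (𝓡 n) ∞ M, c.origin ∈ ψ.source →
      fderiv ℝ (fderiv ℝ (ψ ∘ c.chart.symm)) 0 = fderiv ℝ (fderiv ℝ (ψ ∘ d.chart.symm)) 0

theorem SameJet₁.equivalence : Equivalence (SameJet₁ (n := n) (M := M)) where
  refl _ := ⟨rfl, fun _ _ _ => rfl⟩
  symm {c d} (h : SameJet₁ c d) := ⟨h.1.symm, fun ψ hψ hx => (h.2 ψ hψ (h.1 ▸ hx)).symm⟩
  trans {c d e} (h : SameJet₁ c d) (k : SameJet₁ d e) := ⟨h.1.trans k.1, fun ψ hψ hx => (h.2 ψ hψ hx).trans (k.2 ψ hψ (h.1 ▸ hx))⟩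

theorem SameJet₂.equivalence : Equivalence (SameJet₂ (n := n) (M := M)) where
  refl c := ⟨SameJet₁.equivalence.refl c, fun _ _ _ => rfl⟩
  symm {c d} (h : SameJet₂ c d) := ⟨SameJet₁.equivalence.symm h.1, fun ψ hψ hx => (h.2 ψ hψ (h.1.1 ▸ hx)).symm⟩
  trans {c d e} (h : SameJet₂ c d) (k : SameJet₂ d e) := ⟨SameJet₁.equivalence.trans h.1 k.1,
    fun ψ hψ hx => (h.2 ψ hψ hx).trans (k.2 ψ hψ (h.1.1 ▸ hx))⟩

variable (n M)

/-- The equivalence relation defining 1-frames. -/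
def jetSetoid₁ : Setoid (CenteredChart n M) := ⟨SameJet₁, SameJet₁.equivalence⟩

/-- The equivalence relation defining 2-frames. -/
def jetSetoid₂ : Setoid (CenteredChart n M) := ⟨SameJet₂, SameJet₂.equivalence⟩

/-- `F¹M = LM`, the (total space of the) bundle of 1-frames: 1-jets at `0` of inverse charts. -/
def Frame₁ : Type _ := Quotient (jetSetoid₁ n M)

/-- `F²M`, the (total space of the) bundle of 2-frames: 2-jets at `0` of inverse charts. -/
def Frame₂ : Type _ := Quotient (jetSetoid₂ n M)

variable {n M}

/-- The 1-frame of a chart. -/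
def CenteredChart.frame₁ (c : CenteredChart n M) : Frame₁ n M := Quotient.mk (jetSetoid₁ n M) c

/-- The 2-frame of a chart. -/
def CenteredChart.frame₂ (c : CenteredChart n M) : Frame₂ n M := Quotient.mk (jetSetoid₂ n M) c

/-- The projection `F¹M → M`. -/
def Frame₁.base (l : Frame₁ n M) : M :=
  Quotient.lift CenteredChart.origin (fun c d (h : SameJet₁ c d) => h.1) l

/-- The projection `F²M → F¹M`. -/
def Frame₂.proj (z : Frame₂ n M) : Frame₁ n M :=
  Quotient.lift CenteredChart.frame₁
    (fun c d (h : SameJet₂ c d) => Quotient.sound (s := jetSetoid₁ n M) h.1) z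

/-- The projection `F²M → M`. -/
def Frame₂.base (z : Frame₂ n M) : M := z.proj.base

/-- The fibre coordinate of a 1-frame in the bundle chart of `F¹M` induced by the chart `ψ` of `M`
(meaningful if the frame sits over the domain of `ψ`). -/
def Frame₁.lin (ψ : OpenPartialHomeomorph M (Model n)) (l : Frame₁ n M) :
    Model n →L[ℝ] Model n :=
  fderiv ℝ (ψ ∘ (Quotient.out l).chart.symm) 0

/-- The second-order fibre coordinate of a 2-frame in the bundle chart of `F²M` induced by the
chart `ψ` of `M` (meaningful if the frame sits over the domain of `ψ`). -/
def Frame₂.quad (ψ : OpenPartialHomeomorph M (Model n)) (z : Frame₂ n M) :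
    Model n →L[ℝ] Model n →L[ℝ] Model n :=
  fderiv ℝ (fderiv ℝ (ψ ∘ (Quotient.out z).chart.symm)) 0

/-- The fibre coordinates do not depend on the chart representing the frame. -/
theorem CenteredChart.lin_frame₁ (c : CenteredChart n M) {ψ : OpenPartialHomeomorph M (Model n)}
    (hψ : ψ ∈ IsManifold.maximalAtlas (𝓡 n) ∞ M) (hx : c.origin ∈ ψ.source) :
    c.frame₁.lin ψ = fderiv ℝ (ψ ∘ c.chart.symm) 0 := by
  have h : SameJet₁ (Quotient.out c.frame₁) c :=
    Quotient.mk_out (s := jetSetoid₁ n M) c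
  exact h.2 ψ hψ (h.1 ▸ hx)

theorem CenteredChart.quad_frame₂ (c : CenteredChart n M) {ψ : OpenPartialHomeomorph M (Model n)}
    (hψ : ψ ∈ IsManifold.maximalAtlas (𝓡 n) ∞ M) (hx : c.origin ∈ ψ.source) :
    c.frame₂.quad ψ = fderiv ℝ (fderiv ℝ (ψ ∘ c.chart.symm)) 0 := by
  have h : SameJet₂ (Quotient.out c.frame₂) c :=
    Quotient.mk_out (s := jetSetoid₂ n M) c
  exact h.2 ψ hψ (h.1.1 ▸ hx)

/-- `l' = l · a` for the principal action of `G¹ₙ` on `F¹M`: if `l` is the jet of `c⁻¹` and `l'`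
the jet of `d⁻¹`, then `d⁻¹ = c⁻¹ ∘ φ` where `φ = c ∘ d⁻¹` has the 1-jet `a` at `0`. -/
def IsTranslate₁ (l : Frame₁ n M) (a : G1 n) (l' : Frame₁ n M) : Prop :=
  ∃ c d : CenteredChart n M, c.frame₁ = l ∧ d.frame₁ = l' ∧ c.origin = d.origin ∧
    fderiv ℝ (c.chart ∘ d.chart.symm) 0 = (a : Model n →L[ℝ] Model n)

/-- `z' = z · g` for the principal action of `G²ₙ` on `F²M`: if `z` is the jet of `c⁻¹` and `z'`
the jet of `d⁻¹`, then `d⁻¹ = c⁻¹ ∘ φ` where `φ = c ∘ d⁻¹` has the 2-jet `g` at `0`. -/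
def IsTranslate₂ (z : Frame₂ n M) (g : G2 n) (z' : Frame₂ n M) : Prop :=
  ∃ c d : CenteredChart n M, c.frame₂ = z ∧ d.frame₂ = z' ∧ c.origin = d.origin ∧
    fderiv ℝ (c.chart ∘ d.chart.symm) 0 = (g.lin : Model n →L[ℝ] Model n) ∧
    ∀ u v, fderiv ℝ (fderiv ℝ (c.chart ∘ d.chart.symm)) 0 u v =
      g.lin ((g.quad : Model n →L[ℝ] Model n →L[ℝ] Model n) u v)

/-- `σ` is a smooth section of `F¹M` over the set `U` (used for open `U`). -/
def IsSmoothSection₁ (U : Set M) (σ : M → Frame₁ n M) : Prop :=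
  (∀ x ∈ U, (σ x).base = x) ∧
    ∀ ψ ∈ IsManifold.maximalAtlas (𝓡 n) ∞ M,
      ContMDiffOn (𝓡 n) 𝓘(ℝ, Model n →L[ℝ] Model n) ∞ (fun x => (σ x).lin ψ) (U ∩ ψ.source)

/-- `σ` is a smooth section of `F²M` over the set `U` (used for open `U`). -/
def IsSmoothSection₂ (U : Set M) (σ : M → Frame₂ n M) : Prop :=
  (∀ x ∈ U, (σ x).base = x) ∧
    ∀ ψ ∈ IsManifold.maximalAtlas (𝓡 n) ∞ M,
      ContMDiffOn (𝓡 n) 𝓘(ℝ, Model n →L[ℝ] Model n) ∞ (fun x => (σ x).proj.lin ψ)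
        (U ∩ ψ.source) ∧
      ContMDiffOn (𝓡 n) 𝓘(ℝ, Model n →L[ℝ] Model n →L[ℝ] Model n) ∞ (fun x => (σ x).quad ψ)
        (U ∩ ψ.source)

/-! ### `G`-structures -/

/-- `P` is a first order `G`-structure, i.e. a reduction of `F¹M` to the subgroup `G`: it is
stable under `G`, `G` is transitive on its fibres, and it has smooth local sections around every
point of `M`. -/
structure IsGStructure₁ (G : Subgroup (G1 n)) (P : Set (Frame₁ n M)) : Prop where
  stable : ∀ l ∈ P, ∀ a ∈ G, ∀ l', IsTranslate₁ l a l' → l' ∈ P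
  transitive : ∀ l ∈ P, ∀ l' ∈ P, l.base = l'.base → ∃ a ∈ G, IsTranslate₁ l a l'
  local_section : ∀ x : M, ∃ U : Set M, IsOpen U ∧ x ∈ U ∧
    ∃ σ : M → Frame₁ n M, IsSmoothSection₁ U σ ∧ ∀ y ∈ U, σ y ∈ P

/-- `Q` is a second order `G`-structure, i.e. a reduction of `F²M` to the subgroup `G`. -/
structure IsGStructure₂ (G : Subgroup (G2 n)) (Q : Set (Frame₂ n M)) : Prop where
  stable : ∀ z ∈ Q, ∀ g ∈ G, ∀ z', IsTranslate₂ z g z' → z' ∈ Q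
  transitive : ∀ z ∈ Q, ∀ z' ∈ Q, z.base = z'.base → ∃ g ∈ G, IsTranslate₂ z g z'
  local_section : ∀ x : M, ∃ U : Set M, IsOpen U ∧ x ∈ U ∧
    ∃ σ : M → Frame₂ n M, IsSmoothSection₂ U σ ∧ ∀ y ∈ U, σ y ∈ Q

/-- The extension `Q · G` of a subset `Q` of `F²M` by a subgroup `G` of `G²ₙ`. -/
def extension (G : Subgroup (G2 n)) (Q : Set (Frame₂ n M)) : Set (Frame₂ n M) :=
  {z' | ∃ z ∈ Q, ∃ g ∈ G, IsTranslate₂ z g z'}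

/-- A volume on `M`: a first order `SL^±ₙ`-structure. -/
def IsVolume (V : Set (Frame₁ n M)) : Prop := IsGStructure₁ (SLpm n) V

/-- A symmetric linear connection on `M`: a second order `G¹ₙ`-structure, `G¹ₙ = G¹ₙ ⋊ 0`. -/
def IsSLC (C : Set (Frame₂ n M)) : Prop := IsGStructure₂ (linearSubgroup ⊤) C

/-- A projective structure on `M`: a second order `G¹ₙ ⋊ 𝔭`-structure. -/
def IsProjectiveStructure (Q : Set (Frame₂ n M)) : Prop :=
  IsGStructure₂ (projectiveSubgroup n) Q

/-! ### Transversal subspaces, prolongation, parallel volumes -/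

/-- The tangent space at `l` of a subset `P` of `F¹M`, i.e. the velocities at time `0` of the
smooth curves in `P` through `l`, written in the bundle chart of `F¹M` given by the chart `ψ`. -/
def tangentVectors (ψ : OpenPartialHomeomorph M (Model n)) (P : Set (Frame₁ n M))
    (l : Frame₁ n M) : Set (Model n × (Model n →L[ℝ] Model n)) :=
  {w | ∃ γ : ℝ → Frame₁ n M, γ 0 = l ∧
    (∀ᶠ t in 𝓝 (0 : ℝ), γ t ∈ P ∧ (γ t).base ∈ ψ.source) ∧
    ContDiffAt ℝ ∞ (fun t => (ψ (γ t).base, (γ t).lin ψ)) 0 ∧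
    deriv (fun t => (ψ (γ t).base, (γ t).lin ψ)) 0 = w}

/-- The set of the 2-frames `z` whose torsion-free transversal `n`-subspace `H_l ⊆ T_l(LM)`,
`l = z.proj`, is contained in `T_l P`.  If `z` is the 2-frame of a chart `c`, then `H_l` is the
tangent space at `l` of the field of coordinate frames of `c`; in the bundle chart given by `c`
this field is `u ↦ (u, id)`, so that `H_l` is `ℝⁿ × 0`. -/
def prolongation (P : Set (Frame₁ n M)) : Set (Frame₂ n M) :=
  {z | z.proj ∈ P ∧ ∃ c : CenteredChart n M, c.frame₂ = z ∧
    ∀ v : Model n, (v, (0 : Model n →L[ℝ] Model n)) ∈ tangentVectors c.chart P z.proj}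

/-- The connection `C` makes `V` parallel: at the points of `V`, the horizontal subspaces of `C`
are tangent to `V`. -/
def MakesParallel (C : Set (Frame₂ n M)) (V : Set (Frame₁ n M)) : Prop :=
  ∀ z ∈ C, z.proj ∈ V → z ∈ prolongation V

end Frames

end HigherFrames

end

/-!
The proof works in the coordinates that a chart `ψ` of `M` induces on frames: a 2-frame over a point
of the domain of `ψ` is given by a pair `(A, B)` of an invertible map and a symmetric bilinear map
(`Frame₂.ext_quad`, `Frame₂.exists_coord`), and `(a, s)` acts by
`(A, B) ↦ (A a, B(a, a) + A a s)` (`isTranslate₂_iff`).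

A volume `V` is described by its logarithmic density `H`, a smooth function on the domain of `ψ`
such that `V` consists of the frames with `log |det A| = H`.  In a chart representing a 2-frame, the
horizontal space is tangent to `V` iff `H` is stationary at the origin
(`IsVolume.horizontal_tangent_iff`).  Rewriting this in the chart `ψ` shows that a 2-frame over `V`
belongs to `V²` iff `dH (A v) = tr (A⁻¹ B(v, ·))` for all `v` (`IsVolume.mem_prolongation_iff`).
The trace is expressed throughout as the differential of `log |det|` at `A`, so that only the
multiplicativity of the determinant is needed.

The element of `𝔭` with covector `μ` adds `(n + 1) μ(v)` to this trace
(`fderiv_logDet_projective`).  As `n + 1 ≠ 0`, there is exactly one element of `Q ∩ V²` over each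
frame of `V`, and its coordinates depend smoothly on those of a section of `Q`, on those of a section
of `V` and on `dH`.  Since `V²` is stable under `SL^±ₙ`, it follows that `Q ∩ V²` is an
`SL^±ₙ`-structure (`IsVolume.isGStructure₂_inter_prolongation`).  Its extension by `G¹ₙ` is an SLC
in `Q` that makes `V` parallel, and any other such SLC has the same elements over `V`
(`IsVolume.eq_extension`).
-/

namespace HigherFrames

/-! ### Second derivatives and the logarithm of the determinant -/

section Calculus

/-- The second order chain rule. -/
theorem fderiv_fderiv_comp_apply {E F G : Type*} [NormedAddCommGroup E] [NormedSpace ℝ E]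
    [NormedAddCommGroup F] [NormedSpace ℝ F] [NormedAddCommGroup G] [NormedSpace ℝ G]
    {f : F → G} {g : E → F} {x : E} (hf : ContDiffAt ℝ ∞ f (g x)) (hg : ContDiffAt ℝ ∞ g x)
    (u v : E) :
    fderiv ℝ (fderiv ℝ (f ∘ g)) x u v =
      fderiv ℝ (fderiv ℝ f) (g x) (fderiv ℝ g x u) (fderiv ℝ g x v) +
        fderiv ℝ f (g x) (fderiv ℝ (fderiv ℝ g) x u v) := by
  have hev : fderiv ℝ (f ∘ g) =ᶠ[𝓝 x] fun y => (fderiv ℝ f (g y)).comp (fderiv ℝ g y) := by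
    have h1 : ∀ᶠ y in 𝓝 x, ContDiffAt ℝ 1 g y :=
      (hg.of_le (by exact_mod_cast le_top)).eventually (by simp)
    have h2 : ∀ᶠ y in 𝓝 (g x), ContDiffAt ℝ 1 f y :=
      (hf.of_le (by exact_mod_cast le_top)).eventually (by simp)
    filter_upwards [h1, hg.continuousAt.eventually h2] with y hy1 hy2
    exact fderiv_comp y (hy2.differentiableAt one_ne_zero) (hy1.differentiableAt one_ne_zero)
  have hf' : DifferentiableAt ℝ (fderiv ℝ f) (g x) :=
    (hf.fderiv_right (m := 1) (by norm_cast)).differentiableAt one_ne_zero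
  have hg' : DifferentiableAt ℝ (fderiv ℝ g) x :=
    (hg.fderiv_right (m := 1) (by norm_cast)).differentiableAt one_ne_zero
  have hgd : DifferentiableAt ℝ g x := hg.differentiableAt (by simp)
  rw [hev.fderiv_eq,
    (HasFDerivAt.clm_comp (c := fun y => fderiv ℝ f (g y))
      (hf'.hasFDerivAt.comp x hgd.hasFDerivAt) hg'.hasFDerivAt).fderiv]
  simp [add_comm]

/-- The logarithm of the absolute value of the determinant (`Real.log` is even). -/
noncomputable def logDet {n : ℕ} (A : Model n →L[ℝ] Model n) : ℝ := Real.log A.det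

variable {n : ℕ}

theorem contDiff_det : ContDiff ℝ ∞ fun A : Model n →L[ℝ] Model n => A.det := by
  let b := Module.finBasis ℝ (Model n)
  have h : (fun A : Model n →L[ℝ] Model n => A.det) =
      fun A => ∑ σ : Equiv.Perm _, ((Equiv.Perm.sign σ : ℤ) : ℝ) *
        ∏ i, (b.repr (A (b i)) (σ i)) := by
    funext A
    rw [ContinuousLinearMap.det, ← LinearMap.det_toMatrix b, Matrix.det_apply']
    simp [LinearMap.toMatrix_apply]
  rw [h]
  refine ContDiff.sum fun σ _ => contDiff_const.mul (contDiff_prod fun i _ => ?_)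
  let L : (Model n →L[ℝ] Model n) →ₗ[ℝ] ℝ :=
    { toFun := fun A => b.repr (A (b i)) (σ i)
      map_add' := by intros; simp
      map_smul' := by intros; simp }
  exact (LinearMap.toContinuousLinearMap L).contDiff

theorem contDiffAt_logDet {A : Model n →L[ℝ] Model n} (hA : A.det ≠ 0) :
    ContDiffAt ℝ ∞ logDet A :=
  contDiff_det.contDiffAt.log hA

theorem det_comp (A B : Model n →L[ℝ] Model n) : (A.comp B).det = A.det * B.det :=
  LinearMap.det_comp (A : Model n →ₗ[ℝ] Model n) (B : Model n →ₗ[ℝ] Model n)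

theorem det_id : (ContinuousLinearMap.id ℝ (Model n)).det = 1 :=
  LinearMap.det_id (A := ℝ) (M := Model n)

theorem G1.det_ne_zero (a : G1 n) : (a : Model n →L[ℝ] Model n).det ≠ 0 := by
  have h := det_comp (a : Model n →L[ℝ] Model n) (a.symm : Model n →L[ℝ] Model n)
  rw [a.coe_comp_coe_symm, det_id] at h
  exact left_ne_zero_of_mul_eq_one h.symm

/-- A linear endomorphism with nonzero determinant is the underlying map of an element of
`G¹ₙ`. -/
theorem exists_G1_of_det_ne_zero {A : Model n →L[ℝ] Model n} (hA : A.det ≠ 0) :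
    ∃ a : G1 n, (a : Model n →L[ℝ] Model n) = A :=
  ⟨A.toContinuousLinearEquivOfDetNeZero hA, A.coe_toContinuousLinearEquivOfDetNeZero hA⟩

theorem logDet_id : logDet (ContinuousLinearMap.id ℝ (Model n)) = 0 := by
  rw [logDet, det_id, Real.log_one]

theorem logDet_comp {A B : Model n →L[ℝ] Model n} (hA : A.det ≠ 0) (hB : B.det ≠ 0) :
    logDet (A.comp B) = logDet A + logDet B := by
  rw [logDet, det_comp, Real.log_mul hA hB, logDet, logDet]

theorem mem_SLpm_iff (a : G1 n) : a ∈ SLpm n ↔ logDet (a : Model n →L[ℝ] Model n) = 0 := by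
  have h0 := abs_pos.2 a.det_ne_zero
  rw [logDet, ← Real.log_abs, Real.log_eq_zero]
  change |(a : Model n →L[ℝ] Model n).det| = 1 ↔ _
  constructor
  · exact fun h => Or.inr (Or.inl h)
  · rintro (h | h | h)
    · exact absurd h h0.ne'
    · exact h
    · linarith

/-- The invariance of the differential of `log |det|` under left and right translations. -/
theorem fderiv_logDet_comp (a b : G1 n) {X : Model n →L[ℝ] Model n} (hX : X.det ≠ 0)
    (Y : Model n →L[ℝ] Model n) :
    fderiv ℝ logDet (((a : Model n →L[ℝ] Model n).comp X).comp (b : Model n →L[ℝ] Model n))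
        (((a : Model n →L[ℝ] Model n).comp Y).comp (b : Model n →L[ℝ] Model n)) =
      fderiv ℝ logDet X Y := by
  let T : (Model n →L[ℝ] Model n) →L[ℝ] (Model n →L[ℝ] Model n) :=
    ((ContinuousLinearMap.compL ℝ (Model n) (Model n) (Model n)).flip
        (b : Model n →L[ℝ] Model n)).comp
      (ContinuousLinearMap.compL ℝ (Model n) (Model n) (Model n) (a : Model n →L[ℝ] Model n))
  have hT : ∀ Z, T Z =
    ((a : Model n →L[ℝ] Model n).comp Z).comp (b : Model n →L[ℝ] Model n) := fun _ => rfl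
  have hdet : ∀ Z : Model n →L[ℝ] Model n, Z.det ≠ 0 → logDet (T Z) =
      logDet Z + (logDet (a : Model n →L[ℝ] Model n) + logDet (b : Model n →L[ℝ] Model n)) := by
    intro Z hZ
    have h1 : ((a : Model n →L[ℝ] Model n).comp Z).det ≠ 0 := by
      rw [det_comp]; exact mul_ne_zero a.det_ne_zero hZ
    rw [hT, logDet_comp h1 b.det_ne_zero, logDet_comp a.det_ne_zero hZ]
    ring
  have hTX : (T X).det ≠ 0 := by
    rw [hT, det_comp, det_comp]
    exact mul_ne_zero (mul_ne_zero a.det_ne_zero hX) b.det_ne_zero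
  have hev : logDet ∘ T =ᶠ[𝓝 X] fun Z => logDet Z +
      (logDet (a : Model n →L[ℝ] Model n) + logDet (b : Model n →L[ℝ] Model n)) := by
    filter_upwards [contDiff_det.continuous.continuousAt.eventually_ne hX] with Z hZ
    exact hdet Z hZ
  have h1 := fderiv_comp X ((contDiffAt_logDet hTX).differentiableAt (by simp))
    T.differentiableAt
  rw [hev.fderiv_eq, fderiv_add_const, T.fderiv] at h1
  rw [h1]
  rfl

/-- The differential of `log |det|` at the identity is the trace; this is its value at the element
of `𝔭` given by the covector `μ`, with its first argument fixed to be `v`. -/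
theorem fderiv_logDet_projective (μ : Model n →L[ℝ] ℝ) (v : Model n) :
    fderiv ℝ logDet (ContinuousLinearMap.id ℝ (Model n))
        (μ v • ContinuousLinearMap.id ℝ (Model n) + μ.smulRight v) = (n + 1) * μ v := by
  have hid : (ContinuousLinearMap.id ℝ (Model n)).det ≠ 0 := by rw [det_id]; exact one_ne_zero
  have hd := (contDiffAt_logDet hid).differentiableAt (by simp)
  -- The derivative in the direction `Y` is computed along the line `id + t Y`.
  have key : ∀ (Y : Model n →L[ℝ] Model n) (p : ℝ → ℝ) (c : ℝ), p 0 = 1 → HasDerivAt p c 0 →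
      (∀ t : ℝ, (ContinuousLinearMap.id ℝ (Model n) + t • Y).det = p t) →
      fderiv ℝ logDet (ContinuousLinearMap.id ℝ (Model n)) Y = c := by
    intro Y p c h0 hp hdet
    have hl : HasDerivAt (fun t : ℝ => ContinuousLinearMap.id ℝ (Model n) + t • Y) Y 0 := by
      simpa using ((hasDerivAt_id (0 : ℝ)).smul_const Y).const_add
        (ContinuousLinearMap.id ℝ (Model n))
    have h1 := HasFDerivAt.comp_hasDerivAt_of_eq (0 : ℝ) hd.hasFDerivAt hl
      (by ext1 w; simp)
    have h2 : logDet ∘ (fun t : ℝ => ContinuousLinearMap.id ℝ (Model n) + t • Y) =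
        fun t => Real.log (p t) := by
      funext t
      simp only [Function.comp_apply, logDet, hdet]
    rw [h2] at h1
    have h3 := hp.log (by rw [h0]; exact one_ne_zero)
    rw [h0, div_one] at h3
    exact h1.unique h3
  have hscalar : fderiv ℝ logDet (ContinuousLinearMap.id ℝ (Model n))
      (ContinuousLinearMap.id ℝ (Model n)) = n := by
    refine key _ (fun t => (1 + t) ^ n) n (by simp) ?_ fun t => ?_
    · simpa using ((hasDerivAt_id (0 : ℝ)).const_add 1).fun_pow n
    · have h : ContinuousLinearMap.id ℝ (Model n) + t • ContinuousLinearMap.id ℝ (Model n) =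
          (1 + t) • ContinuousLinearMap.id ℝ (Model n) := by module
      rw [h, ContinuousLinearMap.det, ContinuousLinearMap.toLinearMap_smul, LinearMap.det_smul]
      simp
  have hrankone : fderiv ℝ logDet (ContinuousLinearMap.id ℝ (Model n)) (μ.smulRight v) = μ v := by
    refine key _ (fun t => 1 + t * μ v) (μ v) (by simp) ?_ fun t => ?_
    · simpa using ((hasDerivAt_id (0 : ℝ)).mul_const (μ v)).const_add 1
    · have h := LinearMap.transvection.det (t • (μ : Model n →ₗ[ℝ] ℝ)) v
      have h' : LinearMap.transvection (t • (μ : Model n →ₗ[ℝ] ℝ)) v =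
          ((ContinuousLinearMap.id ℝ (Model n) + t • μ.smulRight v :
            Model n →L[ℝ] Model n) : Model n →ₗ[ℝ] Model n) := by
        ext1 w
        simp [LinearMap.transvection.apply, mul_smul]
      rw [h'] at h
      exact h
  rw [map_add, map_smul, hscalar, hrankone, smul_eq_mul]
  ring

end Calculus

/-! ### Frames in the coordinates of a chart -/

section Coordinates

variable {n : ℕ} {M : Type*} [TopologicalSpace M]

theorem eventually_symm_mem_source {φ ψ : OpenPartialHomeomorph M (Model n)}
    {u : Model n} (hu : u ∈ φ.target) (hx : φ.symm u ∈ ψ.source) :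
    ∀ᶠ v in 𝓝 u, v ∈ φ.target ∧ φ.symm v ∈ ψ.source :=
  (φ.open_target.eventually_mem hu).and
    ((φ.symm.continuousAt hu).eventually (ψ.open_source.eventually_mem hx))

theorem transition_eventuallyEq_comp {φ ψ : OpenPartialHomeomorph M (Model n)}
    (χ : M → Model n) {u : Model n} (hu : u ∈ φ.target) (hx : φ.symm u ∈ ψ.source) :
    χ ∘ φ.symm =ᶠ[𝓝 u] (χ ∘ ψ.symm) ∘ (ψ ∘ φ.symm) := by
  filter_upwards [eventually_symm_mem_source hu hx] with v hv
  simp only [Function.comp_apply, ψ.left_inv hv.2]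

variable [ChartedSpace (Model n) M]

theorem contDiffAt_transition [IsManifold (𝓡 n) ∞ M] {φ ψ : OpenPartialHomeomorph M (Model n)}
    (hφ : φ ∈ IsManifold.maximalAtlas (𝓡 n) ∞ M) (hψ : ψ ∈ IsManifold.maximalAtlas (𝓡 n) ∞ M)
    {u : Model n} (hu : u ∈ φ.target) (hx : φ.symm u ∈ ψ.source) :
    ContDiffAt ℝ ∞ (ψ ∘ φ.symm) u :=
  contMDiffAt_iff_contDiffAt.1 ((contMDiffAt_of_mem_maximalAtlas hψ hx).comp u
    (contMDiffAt_symm_of_mem_maximalAtlas hφ hu))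

theorem det_fderiv_transition_ne_zero [IsManifold (𝓡 n) ∞ M]
    {φ ψ : OpenPartialHomeomorph M (Model n)}
    (hφ : φ ∈ IsManifold.maximalAtlas (𝓡 n) ∞ M) (hψ : ψ ∈ IsManifold.maximalAtlas (𝓡 n) ∞ M)
    {u : Model n} (hu : u ∈ φ.target) (hx : φ.symm u ∈ ψ.source) :
    (fderiv ℝ (ψ ∘ φ.symm) u).det ≠ 0 := by
  have h1 := contDiffAt_transition hφ hψ hu hx
  have h2 : ContDiffAt ℝ ∞ (φ ∘ ψ.symm) ((ψ ∘ φ.symm) u) :=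
    contDiffAt_transition hψ hφ (ψ.map_source hx)
      (by simpa [ψ.left_inv hx] using φ.map_target hu)
  have h3 : (φ ∘ ψ.symm) ∘ (ψ ∘ φ.symm) =ᶠ[𝓝 u] id := by
    filter_upwards [eventually_symm_mem_source hu hx] with v hv
    simp only [Function.comp_apply, ψ.left_inv hv.2, φ.right_inv hv.1, id]
  have h4 := fderiv_comp u (h2.differentiableAt (by simp)) (h1.differentiableAt (by simp))
  rw [h3.fderiv_eq, fderiv_id] at h4
  have h5 := congrArg ContinuousLinearMap.det h4
  rw [det_comp, det_id] at h5
  exact right_ne_zero_of_mul_eq_one h5.symm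

theorem CenteredChart.origin_mem_source (c : CenteredChart n M) : c.origin ∈ c.chart.source :=
  c.chart.map_target c.zero_mem

theorem CenteredChart.chart_origin (c : CenteredChart n M) : c.chart c.origin = 0 :=
  c.chart.right_inv c.zero_mem

theorem Frame₁.exists_rep (l : Frame₁ n M) : ∃ c : CenteredChart n M, c.frame₁ = l :=
  Quotient.exists_rep l

theorem Frame₂.exists_rep (z : Frame₂ n M) : ∃ c : CenteredChart n M, c.frame₂ = z :=
  Quotient.exists_rep z

theorem CenteredChart.lin_frame₁_self (c : CenteredChart n M) :
    c.frame₁.lin c.chart = ContinuousLinearMap.id ℝ (Model n) := by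
  rw [c.lin_frame₁ c.mem_atlas c.origin_mem_source]
  have h : c.chart ∘ c.chart.symm =ᶠ[𝓝 0] id := by
    filter_upwards [c.chart.open_target.eventually_mem c.zero_mem] with v hv
    exact c.chart.right_inv hv
  rw [h.fderiv_eq, fderiv_id]

variable [IsManifold (𝓡 n) ∞ M] {ψ χ : OpenPartialHomeomorph M (Model n)}

theorem CenteredChart.contDiffAt_comp_symm (c : CenteredChart n M)
    (hψ : ψ ∈ IsManifold.maximalAtlas (𝓡 n) ∞ M) (hx : c.origin ∈ ψ.source) :
    ContDiffAt ℝ ∞ (ψ ∘ c.chart.symm) 0 :=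
  contDiffAt_transition c.mem_atlas hψ c.zero_mem hx

/-- The transformation of the fibre coordinate of a 1-frame under a change of charts. -/
theorem Frame₁.lin_change (hψ : ψ ∈ IsManifold.maximalAtlas (𝓡 n) ∞ M)
    (hχ : χ ∈ IsManifold.maximalAtlas (𝓡 n) ∞ M) {l : Frame₁ n M} (h : l.base ∈ ψ.source)
    (h' : l.base ∈ χ.source) :
    l.lin χ = (fderiv ℝ (χ ∘ ψ.symm) (ψ l.base)).comp (l.lin ψ) := by
  obtain ⟨c, rfl⟩ := l.exists_rep
  change c.origin ∈ _ at h h'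
  change _ = (fderiv ℝ (χ ∘ ψ.symm) ((ψ ∘ c.chart.symm) 0)).comp _
  have h2 : ContDiffAt ℝ ∞ (χ ∘ ψ.symm) ((ψ ∘ c.chart.symm) 0) :=
    contDiffAt_transition hψ hχ (ψ.map_source h)
      (show ψ.symm (ψ c.origin) ∈ χ.source by rwa [ψ.left_inv h])
  rw [c.lin_frame₁ hχ h', c.lin_frame₁ hψ h,
    (transition_eventuallyEq_comp χ c.zero_mem h).fderiv_eq,
    fderiv_comp _ (h2.differentiableAt (by simp))
      ((c.contDiffAt_comp_symm hψ h).differentiableAt (by simp))]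

/-- The transformation of the second order coordinate of a 2-frame under a change of charts. -/
theorem Frame₂.quad_change (hψ : ψ ∈ IsManifold.maximalAtlas (𝓡 n) ∞ M)
    (hχ : χ ∈ IsManifold.maximalAtlas (𝓡 n) ∞ M) {z : Frame₂ n M} (h : z.base ∈ ψ.source)
    (h' : z.base ∈ χ.source) (u v : Model n) :
    z.quad χ u v =
      fderiv ℝ (fderiv ℝ (χ ∘ ψ.symm)) (ψ z.base) (z.proj.lin ψ u) (z.proj.lin ψ v) +
        fderiv ℝ (χ ∘ ψ.symm) (ψ z.base) (z.quad ψ u v) := by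
  obtain ⟨c, rfl⟩ := z.exists_rep
  change c.origin ∈ _ at h h'
  change _ = fderiv ℝ (fderiv ℝ (χ ∘ ψ.symm)) ((ψ ∘ c.chart.symm) 0) (c.frame₁.lin ψ u)
    (c.frame₁.lin ψ v) + fderiv ℝ (χ ∘ ψ.symm) ((ψ ∘ c.chart.symm) 0) _
  have h2 : ContDiffAt ℝ ∞ (χ ∘ ψ.symm) ((ψ ∘ c.chart.symm) 0) :=
    contDiffAt_transition hψ hχ (ψ.map_source h)
      (show ψ.symm (ψ c.origin) ∈ χ.source by rwa [ψ.left_inv h])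
  rw [c.quad_frame₂ hχ h', c.quad_frame₂ hψ h, c.lin_frame₁ hψ h,
    (transition_eventuallyEq_comp χ c.zero_mem h).fderiv.fderiv_eq,
    fderiv_fderiv_comp_apply h2 (c.contDiffAt_comp_symm hψ h)]

theorem Frame₁.det_lin_ne_zero (hψ : ψ ∈ IsManifold.maximalAtlas (𝓡 n) ∞ M) {l : Frame₁ n M}
    (h : l.base ∈ ψ.source) : (l.lin ψ).det ≠ 0 := by
  obtain ⟨c, rfl⟩ := l.exists_rep
  rw [c.lin_frame₁ hψ h]
  exact det_fderiv_transition_ne_zero c.mem_atlas hψ c.zero_mem h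

theorem Frame₁.exists_lin_eq (hψ : ψ ∈ IsManifold.maximalAtlas (𝓡 n) ∞ M) {l : Frame₁ n M}
    (h : l.base ∈ ψ.source) : ∃ a : G1 n, (a : Model n →L[ℝ] Model n) = l.lin ψ :=
  exists_G1_of_det_ne_zero (l.det_lin_ne_zero hψ h)

theorem Frame₂.quad_symm (hψ : ψ ∈ IsManifold.maximalAtlas (𝓡 n) ∞ M) {z : Frame₂ n M}
    (h : z.base ∈ ψ.source) (u v : Model n) : z.quad ψ u v = z.quad ψ v u := by
  obtain ⟨c, rfl⟩ := z.exists_rep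
  rw [c.quad_frame₂ hψ h]
  exact (c.contDiffAt_comp_symm hψ h).isSymmSndFDerivAt
    (by simpa using WithTop.coe_le_coe.2 (le_top : (2 : ℕ∞) ≤ ⊤)) u v

theorem Frame₁.ext_lin (hψ : ψ ∈ IsManifold.maximalAtlas (𝓡 n) ∞ M) {l l' : Frame₁ n M}
    (h : l.base ∈ ψ.source) (hb : l.base = l'.base) (hl : l.lin ψ = l'.lin ψ) : l = l' := by
  obtain ⟨c, rfl⟩ := l.exists_rep
  obtain ⟨d, rfl⟩ := l'.exists_rep
  refine Quotient.sound (s := jetSetoid₁ n M) ⟨hb, fun χ hχ hx => ?_⟩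
  rw [← c.lin_frame₁ hχ hx, ← d.lin_frame₁ hχ (by rwa [← show c.origin = d.origin from hb]),
    Frame₁.lin_change hψ hχ h hx, Frame₁.lin_change hψ hχ (hb ▸ h) (hb ▸ hx), hl, hb]

theorem Frame₂.ext_quad (hψ : ψ ∈ IsManifold.maximalAtlas (𝓡 n) ∞ M) {z z' : Frame₂ n M}
    (h : z.base ∈ ψ.source) (hp : z.proj = z'.proj) (hq : ∀ u v, z.quad ψ u v = z'.quad ψ u v) :
    z = z' := by
  have hb : z.base = z'.base := congrArg Frame₁.base hp
  obtain ⟨c, rfl⟩ := z.exists_rep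
  obtain ⟨d, rfl⟩ := z'.exists_rep
  refine Quotient.sound (s := jetSetoid₂ n M)
    ⟨Quotient.exact (s := jetSetoid₁ n M) hp, fun χ hχ hx => ?_⟩
  rw [← c.quad_frame₂ hχ hx, ← d.quad_frame₂ hχ (by rwa [← show c.origin = d.origin from hb])]
  ext1 u
  ext1 v
  rw [Frame₂.quad_change hψ hχ h hx, Frame₂.quad_change hψ hχ (hb ▸ h) (hb ▸ hx), hq, hp, hb]

/-- Every local diffeomorphism `P` at `0` with values in the image of `ψ` is, near `0`, the
coordinate expression of the inverse of a chart. -/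
theorem exists_centeredChart (hψ : ψ ∈ IsManifold.maximalAtlas (𝓡 n) ∞ M)
    {P : Model n → Model n} (hP : ContDiff ℝ ∞ P) (hP0 : P 0 ∈ ψ.target)
    (hdet : (fderiv ℝ P 0).det ≠ 0) :
    ∃ d : CenteredChart n M, d.origin = ψ.symm (P 0) ∧ ψ ∘ d.chart.symm =ᶠ[𝓝 0] P := by
  obtain ⟨a, ha⟩ := exists_G1_of_det_ne_zero hdet
  have hPa : HasFDerivAt P (a : Model n →L[ℝ] Model n) 0 := by
    rw [ha]; exact (hP.differentiable (by simp) 0).hasFDerivAt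
  -- The domain is shrunk so that the derivative is invertible, hence the inverse smooth, on it.
  let S : Set (Model n) := {u | (fderiv ℝ P u).det ≠ 0}
  have hS : IsOpen S := isOpen_ne.preimage
    (contDiff_det.continuous.comp (hP.continuous_fderiv (by simp)))
  let e := (hP.contDiffAt.toOpenPartialHomeomorph P hPa (by simp)).restrOpen S hS
  have heP : ∀ u, e u = P u := fun _ => rfl
  have h0 : (0 : Model n) ∈ e.source :=
    ⟨hP.contDiffAt.mem_toOpenPartialHomeomorph_source hPa (by simp), hdet⟩
  have hsymm : ContDiffOn ℝ ∞ e.symm e.target := by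
    intro y hy
    have hy' : e.symm y ∈ e.source := e.map_target hy
    obtain ⟨b, hb⟩ := exists_G1_of_det_ne_zero (show (fderiv ℝ P (e.symm y)).det ≠ 0 from hy'.2)
    refine (e.contDiffAt_symm (f₀' := b) hy ?_ hP.contDiffAt).contDiffWithinAt
    rw [hb]
    exact (hP.differentiable (by simp) _).hasFDerivAt
  have hmem : ψ.trans e.symm ∈ IsManifold.maximalAtlas (𝓡 n) ∞ M := by
    apply OpenPartialHomeomorph.mem_maximalAtlas_of_contMDiffOn
    · exact hsymm.contMDiffOn.comp
        ((contMDiffOn_of_mem_maximalAtlas hψ).mono fun y hy => hy.1) fun y hy => hy.2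
    · exact (contMDiffOn_symm_of_mem_maximalAtlas hψ).comp
        (hP.contMDiff.contMDiffOn (s := (ψ.trans e.symm).target)) fun y hy => hy.2
  have hz : (0 : Model n) ∈ (ψ.trans e.symm).target := ⟨h0, hP0⟩
  refine ⟨⟨ψ.trans e.symm, hmem, hz⟩, rfl, ?_⟩
  filter_upwards [(ψ.trans e.symm).open_target.eventually_mem hz] with u hu
  exact ψ.right_inv hu.2

/-- The fibre of `F²M` over a point of the domain of `ψ` consists, in the coordinates induced by
`ψ`, of all the pairs of an invertible map and a symmetric bilinear map. -/
theorem Frame₂.exists_coord (hψ : ψ ∈ IsManifold.maximalAtlas (𝓡 n) ∞ M) {x : M}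
    (hx : x ∈ ψ.source) (a : G1 n) (B : Model n →L[ℝ] Model n →L[ℝ] Model n)
    (hB : ∀ u v, B u v = B v u) :
    ∃ z : Frame₂ n M, z.base = x ∧ z.proj.lin ψ = a ∧ z.quad ψ = B := by
  let P : Model n → Model n := fun u => ψ x + (a u + (2⁻¹ : ℝ) • B u u)
  have hP : ContDiff ℝ ∞ P := contDiff_const.add ((a.contDiff).add
    ((B.contDiff.clm_apply contDiff_id).const_smul _))
  have hfd : ∀ u, HasFDerivAt P ((a : Model n →L[ℝ] Model n) + B u) u := by
    intro u
    have h := ((a.hasFDerivAt (x := u)).add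
      (((B.hasFDerivAt (x := u)).clm_apply (hasFDerivAt_id u)).const_smul
        (2⁻¹ : ℝ))).const_add (ψ x)
    refine h.congr_fderiv ?_
    ext1 v
    simp only [add_apply, smul_apply, ContinuousLinearMap.comp_apply,
      ContinuousLinearMap.flip_apply, id, ContinuousLinearMap.id_apply, hB v u]
    module
  have hfd' : fderiv ℝ P = fun u => (a : Model n →L[ℝ] Model n) + B u :=
    funext fun u => (hfd u).fderiv
  have hP0 : P 0 = ψ x := by simp [P]
  have hd0 : fderiv ℝ P 0 = a := by rw [hfd']; simp
  have hdd : fderiv ℝ (fderiv ℝ P) 0 = B := by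
    rw [hfd', fderiv_const_add, B.fderiv]
  obtain ⟨d, hd, hdP⟩ := exists_centeredChart hψ hP (by rw [hP0]; exact ψ.map_source hx)
    (by rw [hd0]; exact a.det_ne_zero)
  rw [hP0, ψ.left_inv hx] at hd
  have hds : d.origin ∈ ψ.source := by rwa [hd]
  refine ⟨d.frame₂, hd, ?_, ?_⟩
  · rw [← hd0, ← hdP.fderiv_eq]
    exact d.lin_frame₁ hψ hds
  · rw [d.quad_frame₂ hψ hds, hdP.fderiv.fderiv_eq, hdd]

theorem Frame₁.exists_coord (hψ : ψ ∈ IsManifold.maximalAtlas (𝓡 n) ∞ M) {x : M}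
    (hx : x ∈ ψ.source) (a : G1 n) :
    ∃ l : Frame₁ n M, l.base = x ∧ l.lin ψ = a := by
  obtain ⟨z, h1, h2, -⟩ := Frame₂.exists_coord hψ hx a 0 (by simp)
  exact ⟨z.proj, h1, h2⟩

end Coordinates

/-! ### The principal actions in coordinates -/

section Action

variable {n : ℕ} {M : Type*} [TopologicalSpace M] [ChartedSpace (Model n) M]
  [IsManifold (𝓡 n) ∞ M] {ψ : OpenPartialHomeomorph M (Model n)}

theorem CenteredChart.lin_eq_comp (hψ : ψ ∈ IsManifold.maximalAtlas (𝓡 n) ∞ M)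
    {c d : CenteredChart n M} (hcd : c.origin = d.origin) (h : c.origin ∈ ψ.source) :
    d.frame₁.lin ψ = (c.frame₁.lin ψ).comp (fderiv ℝ (c.chart ∘ d.chart.symm) 0) := by
  have hd : d.frame₁.base ∈ c.chart.source := by
    change d.origin ∈ _; rw [← hcd]; exact c.origin_mem_source
  have h1 := Frame₁.lin_change c.mem_atlas hψ hd (show d.origin ∈ _ from hcd ▸ h)
  rw [show c.chart d.frame₁.base = 0 by
    change c.chart d.origin = 0; rw [← hcd, c.chart_origin]] at h1
  rw [h1, c.lin_frame₁ hψ h, d.lin_frame₁ c.mem_atlas hd]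

theorem CenteredChart.quad_eq (hψ : ψ ∈ IsManifold.maximalAtlas (𝓡 n) ∞ M)
    {c d : CenteredChart n M} (hcd : c.origin = d.origin) (h : c.origin ∈ ψ.source)
    (u v : Model n) :
    d.frame₂.quad ψ u v =
      c.frame₂.quad ψ (fderiv ℝ (c.chart ∘ d.chart.symm) 0 u)
          (fderiv ℝ (c.chart ∘ d.chart.symm) 0 v) +
        c.frame₁.lin ψ (fderiv ℝ (fderiv ℝ (c.chart ∘ d.chart.symm)) 0 u v) := by
  have hd : d.frame₂.base ∈ c.chart.source := by
    change d.origin ∈ _; rw [← hcd]; exact c.origin_mem_source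
  have h1 := Frame₂.quad_change c.mem_atlas hψ hd (show d.origin ∈ _ from hcd ▸ h) u v
  rw [show c.chart d.frame₂.base = 0 by
    change c.chart d.origin = 0; rw [← hcd, c.chart_origin]] at h1
  rw [h1, c.lin_frame₁ hψ h, c.quad_frame₂ hψ h, d.quad_frame₂ c.mem_atlas hd,
    show d.frame₂.proj = d.frame₁ from rfl, d.lin_frame₁ c.mem_atlas hd]

theorem comp_left_cancel {A X Y : Model n →L[ℝ] Model n} (hA : A.det ≠ 0)
    (h : A.comp X = A.comp Y) : X = Y := by
  obtain ⟨a, rfl⟩ := exists_G1_of_det_ne_zero hA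
  ext1 u
  exact a.injective (DFunLike.congr_fun h u)

theorem apply_left_cancel {A : Model n →L[ℝ] Model n} (hA : A.det ≠ 0) {u v : Model n}
    (h : A u = A v) : u = v := by
  obtain ⟨a, rfl⟩ := exists_G1_of_det_ne_zero hA
  exact a.injective h

theorem isTranslate₁_iff (hψ : ψ ∈ IsManifold.maximalAtlas (𝓡 n) ∞ M) {l l' : Frame₁ n M}
    (h : l.base ∈ ψ.source) (a : G1 n) :
    IsTranslate₁ l a l' ↔
      l'.base = l.base ∧ l'.lin ψ = (l.lin ψ).comp (a : Model n →L[ℝ] Model n) := by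
  constructor
  · rintro ⟨c, d, rfl, rfl, hcd, ha⟩
    exact ⟨hcd.symm, by rw [← ha, CenteredChart.lin_eq_comp hψ hcd h]⟩
  · rintro ⟨hb, hl⟩
    obtain ⟨c, rfl⟩ := l.exists_rep
    obtain ⟨d, rfl⟩ := l'.exists_rep
    refine ⟨c, d, rfl, rfl, hb.symm, ?_⟩
    rw [CenteredChart.lin_eq_comp hψ hb.symm h] at hl
    exact comp_left_cancel (Frame₁.det_lin_ne_zero hψ h) hl

theorem isTranslate₂_iff (hψ : ψ ∈ IsManifold.maximalAtlas (𝓡 n) ∞ M) {z z' : Frame₂ n M}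
    (h : z.base ∈ ψ.source) (g : G2 n) :
    IsTranslate₂ z g z' ↔
      z'.base = z.base ∧ z'.proj.lin ψ = (z.proj.lin ψ).comp (g.lin : Model n →L[ℝ] Model n) ∧
      ∀ u v, z'.quad ψ u v = z.quad ψ (g.lin u) (g.lin v) +
        z.proj.lin ψ (g.lin ((g.quad : Model n →L[ℝ] Model n →L[ℝ] Model n) u v)) := by
  constructor
  · rintro ⟨c, d, rfl, rfl, hcd, ha, hq⟩
    refine ⟨hcd.symm, by rw [← ha]; exact CenteredChart.lin_eq_comp hψ hcd h, fun u v => ?_⟩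
    rw [CenteredChart.quad_eq hψ hcd h, hq, ha]
    rfl
  · rintro ⟨hb, hl, hq⟩
    obtain ⟨c, rfl⟩ := z.exists_rep
    obtain ⟨d, rfl⟩ := z'.exists_rep
    have hA : (c.frame₁.lin ψ).det ≠ 0 := Frame₁.det_lin_ne_zero hψ h
    have ha : fderiv ℝ (c.chart ∘ d.chart.symm) 0 = (g.lin : Model n →L[ℝ] Model n) :=
      comp_left_cancel hA ((CenteredChart.lin_eq_comp hψ hb.symm h).symm.trans hl)
    refine ⟨c, d, rfl, rfl, hb.symm, ha, fun u v => apply_left_cancel hA ?_⟩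
    have h1 := hq u v
    rw [CenteredChart.quad_eq hψ hb.symm h, ha] at h1
    exact add_left_cancel h1

omit [IsManifold (𝓡 n) ∞ M] in
theorem IsTranslate₂.proj {z z' : Frame₂ n M} {g : G2 n} (h : IsTranslate₂ z g z') :
    IsTranslate₁ z.proj g.lin z'.proj := by
  obtain ⟨c, d, rfl, rfl, hcd, ha, -⟩ := h
  exact ⟨c, d, rfl, rfl, hcd, ha⟩

omit [IsManifold (𝓡 n) ∞ M] in
theorem IsTranslate₂.base_eq {z z' : Frame₂ n M} {g : G2 n} (h : IsTranslate₂ z g z') :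
    z'.base = z.base := by
  obtain ⟨c, d, rfl, rfl, hcd, -⟩ := h
  exact hcd.symm

theorem IsTranslate₁.unique {l l₁ l₂ : Frame₁ n M} {a : G1 n} (h₁ : IsTranslate₁ l a l₁)
    (h₂ : IsTranslate₁ l a l₂) : l₁ = l₂ := by
  have hψ := IsManifold.chart_mem_maximalAtlas (I := 𝓡 n) (n := ∞) l.base
  have hx := mem_chart_source (Model n) l.base
  rw [isTranslate₁_iff hψ hx] at h₁ h₂
  exact Frame₁.ext_lin hψ (h₁.1.symm ▸ hx) (h₁.1.trans h₂.1.symm) (h₁.2.trans h₂.2.symm)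

theorem IsTranslate₂.unique {z z₁ z₂ : Frame₂ n M} {g : G2 n} (h₁ : IsTranslate₂ z g z₁)
    (h₂ : IsTranslate₂ z g z₂) : z₁ = z₂ := by
  have hψ := IsManifold.chart_mem_maximalAtlas (I := 𝓡 n) (n := ∞) z.base
  have hx := mem_chart_source (Model n) z.base
  have hp : z₁.proj = z₂.proj := h₁.proj.unique h₂.proj
  rw [isTranslate₂_iff hψ hx] at h₁ h₂
  exact Frame₂.ext_quad hψ (h₁.1.symm ▸ hx) hp fun u v => (h₁.2.2 u v).trans (h₂.2.2 u v).symm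

theorem exists_isTranslate₁_of_base_eq {l l' : Frame₁ n M} (h : l.base = l'.base) :
    ∃ a : G1 n, IsTranslate₁ l a l' := by
  obtain ⟨c, rfl⟩ := l.exists_rep
  obtain ⟨d, rfl⟩ := l'.exists_rep
  have hd : d.origin ∈ c.chart.source := by
    rw [← show c.origin = d.origin from h]; exact c.origin_mem_source
  obtain ⟨a, ha⟩ := exists_G1_of_det_ne_zero
    (det_fderiv_transition_ne_zero d.mem_atlas c.mem_atlas d.zero_mem hd)
  exact ⟨a, c, d, rfl, rfl, h, ha.symm⟩

theorem exists_isTranslate₂ (z : Frame₂ n M) (g : G2 n) : ∃ z', IsTranslate₂ z g z' := by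
  have hψ := IsManifold.chart_mem_maximalAtlas (I := 𝓡 n) (n := ∞) z.base
  have hx := mem_chart_source (Model n) z.base
  obtain ⟨a, ha⟩ := z.proj.exists_lin_eq hψ hx
  let B : Model n →L[ℝ] Model n →L[ℝ] Model n :=
    (z.quad (chartAt (Model n) z.base)).bilinearComp (g.lin : Model n →L[ℝ] Model n)
        (g.lin : Model n →L[ℝ] Model n) +
      (ContinuousLinearMap.compL ℝ (Model n) (Model n) (Model n)
        ((a * g.lin : G1 n) : Model n →L[ℝ] Model n)).comp
          (g.quad : Model n →L[ℝ] Model n →L[ℝ] Model n)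
  have hB : ∀ u v, B u v = z.quad (chartAt (Model n) z.base) (g.lin u) (g.lin v) +
      a (g.lin ((g.quad : Model n →L[ℝ] Model n →L[ℝ] Model n) u v)) := fun _ _ => rfl
  obtain ⟨z', hb, hl, hq⟩ := Frame₂.exists_coord hψ hx (a * g.lin) B fun u v => by
    rw [hB, hB, z.quad_symm hψ hx, g.quad.2]
  refine ⟨z', (isTranslate₂_iff hψ hx g).2 ⟨hb, ?_, fun u v => ?_⟩⟩
  · rw [hl, ← ha]; rfl
  · rw [hq, hB, ← ha]; rfl

theorem IsTranslate₂.trans {z z' z'' : Frame₂ n M} {g h : G2 n} (hg : IsTranslate₂ z g z')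
    (hh : IsTranslate₂ z' h z'') : IsTranslate₂ z (g * h) z'' := by
  have hψ := IsManifold.chart_mem_maximalAtlas (I := 𝓡 n) (n := ∞) z.base
  have hx := mem_chart_source (Model n) z.base
  rw [isTranslate₂_iff hψ hx] at hg ⊢
  rw [isTranslate₂_iff hψ (hg.1.symm ▸ hx)] at hh
  refine ⟨hh.1.trans hg.1, by rw [hh.2.1, hg.2.1]; rfl, fun u v => ?_⟩
  rw [hh.2.2, hg.2.2, hg.2.1]
  have hmul : ∀ w, (g.lin * h.lin) w = g.lin (h.lin w) := fun _ => rfl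
  simp [hmul, add_assoc]

theorem isTranslate₂_one (z : Frame₂ n M) : IsTranslate₂ z 1 z := by
  have hψ := IsManifold.chart_mem_maximalAtlas (I := 𝓡 n) (n := ∞) z.base
  have hx := mem_chart_source (Model n) z.base
  exact (isTranslate₂_iff hψ hx 1).2 ⟨rfl, rfl, fun u v => by simp; rfl⟩

theorem IsTranslate₂.symm {z z' : Frame₂ n M} {g : G2 n} (hg : IsTranslate₂ z g z') :
    IsTranslate₂ z' g⁻¹ z := by
  obtain ⟨z'', h⟩ := exists_isTranslate₂ z' g⁻¹
  have h1 := hg.trans h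
  rw [mul_inv_cancel] at h1
  rwa [h1.unique (isTranslate₂_one z)] at h

end Action

/-! ### The density of a volume and the set `V²` -/

section Volume

variable {n : ℕ} {M : Type*} [TopologicalSpace M] [ChartedSpace (Model n) M]
  {V : Set (Frame₁ n M)}

open Classical in
/-- The logarithmic density of a volume `V` with respect to a chart `ψ`: the common value of
`log |det|` on the coordinates of the frames in `V` over a point (and `0` where there are none). -/
noncomputable def logDensity (V : Set (Frame₁ n M)) (ψ : OpenPartialHomeomorph M (Model n))
    (x : M) : ℝ :=
  if h : ∃ l ∈ V, l.base = x then logDet (h.choose.lin ψ) else 0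

theorem IsVolume.exists_mem (hV : IsVolume V) (x : M) : ∃ l ∈ V, l.base = x := by
  obtain ⟨U, -, hxU, σ, hσ, hσV⟩ := hV.local_section x
  exact ⟨σ x, hσV x hxU, hσ.1 x hxU⟩

variable [IsManifold (𝓡 n) ∞ M] {ψ : OpenPartialHomeomorph M (Model n)}

theorem IsVolume.logDensity_base (hV : IsVolume V)
    (hψ : ψ ∈ IsManifold.maximalAtlas (𝓡 n) ∞ M) {l : Frame₁ n M} (hl : l ∈ V)
    (h : l.base ∈ ψ.source) : logDensity V ψ l.base = logDet (l.lin ψ) := by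
  have hex : ∃ l' ∈ V, l'.base = l.base := ⟨l, hl, rfl⟩
  rw [logDensity, dif_pos hex]
  obtain ⟨h1, h2⟩ := hex.choose_spec
  obtain ⟨a, ha, hla⟩ := hV.transitive l hl _ h1 h2.symm
  rw [((isTranslate₁_iff hψ h a).1 hla).2,
    logDet_comp (l.det_lin_ne_zero hψ h) a.det_ne_zero, (mem_SLpm_iff a).1 ha, add_zero]

theorem IsVolume.mem_iff (hV : IsVolume V) (hψ : ψ ∈ IsManifold.maximalAtlas (𝓡 n) ∞ M)
    {l : Frame₁ n M} (h : l.base ∈ ψ.source) :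
    l ∈ V ↔ logDet (l.lin ψ) = logDensity V ψ l.base := by
  refine ⟨fun hl => (hV.logDensity_base hψ hl h).symm, fun hl => ?_⟩
  obtain ⟨l', hl', hb⟩ := hV.exists_mem l.base
  obtain ⟨a, ha⟩ := exists_isTranslate₁_of_base_eq hb
  refine hV.stable l' hl' a ((mem_SLpm_iff a).2 ?_) l ha
  have h' : l'.base ∈ ψ.source := hb ▸ h
  rw [← hb, hV.logDensity_base hψ hl' h', ((isTranslate₁_iff hψ h' a).1 ha).2,
    logDet_comp (l'.det_lin_ne_zero hψ h') a.det_ne_zero] at hl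
  linarith

/-- Two frames in `V` over the same point differ by an element of `SL^±ₙ`. -/
theorem IsVolume.mem_SLpm (hV : IsVolume V) {l l' : Frame₁ n M} (hl : l ∈ V) (hl' : l' ∈ V)
    {a : G1 n} (h : IsTranslate₁ l a l') : a ∈ SLpm n := by
  have hψ := IsManifold.chart_mem_maximalAtlas (I := 𝓡 n) (n := ∞) l.base
  have hx := mem_chart_source (Model n) l.base
  obtain ⟨hb, hc⟩ := (isTranslate₁_iff hψ hx a).1 h
  rw [mem_SLpm_iff]
  have h1 := hV.logDensity_base hψ hl hx
  have h2 := hV.logDensity_base hψ hl' (hb.symm ▸ hx)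
  rw [hb, h1, hc, logDet_comp (l.det_lin_ne_zero hψ hx) a.det_ne_zero] at h2
  linarith

theorem IsVolume.contMDiffOn_logDensity (hV : IsVolume V)
    (hψ : ψ ∈ IsManifold.maximalAtlas (𝓡 n) ∞ M) :
    ContMDiffOn (𝓡 n) 𝓘(ℝ, ℝ) ∞ (logDensity V ψ) ψ.source := by
  intro x hx
  obtain ⟨U, hU, hxU, σ, hσ, hσV⟩ := hV.local_section x
  have hnhds : U ∩ ψ.source ∈ 𝓝 x := (hU.inter ψ.open_source).mem_nhds ⟨hxU, hx⟩
  have h1 : ContMDiffAt (𝓡 n) 𝓘(ℝ, Model n →L[ℝ] Model n) ∞ (fun y => (σ y).lin ψ) x :=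
    (hσ.2 ψ hψ).contMDiffAt hnhds
  have h2 : ContMDiffAt (𝓡 n) 𝓘(ℝ, ℝ) ∞ (fun y => logDet ((σ y).lin ψ)) x :=
    ContMDiffAt.comp (g := logDet) x (contDiffAt_logDet ((σ x).det_lin_ne_zero hψ
      (by rwa [hσ.1 x hxU]))).contMDiffAt h1
  refine (h2.congr_of_eventuallyEq ?_).contMDiffWithinAt
  filter_upwards [hnhds] with y hy
  have hb := hσ.1 y hy.1
  rw [← hV.logDensity_base hψ (hσV y hy.1) (hb.symm ▸ hy.2), hb]

theorem IsVolume.contDiffAt_logDensity (hV : IsVolume V)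
    (hψ : ψ ∈ IsManifold.maximalAtlas (𝓡 n) ∞ M) {u : Model n} (hu : u ∈ ψ.target) :
    ContDiffAt ℝ ∞ (logDensity V ψ ∘ ψ.symm) u :=
  contMDiffAt_iff_contDiffAt.1
    (((hV.contMDiffOn_logDensity hψ).contMDiffAt
      (ψ.open_source.mem_nhds (ψ.map_target hu))).comp u
        (contMDiffAt_symm_of_mem_maximalAtlas hψ hu))

theorem IsVolume.logDensity_change (hV : IsVolume V) {φ : OpenPartialHomeomorph M (Model n)}
    (hφ : φ ∈ IsManifold.maximalAtlas (𝓡 n) ∞ M)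
    (hψ : ψ ∈ IsManifold.maximalAtlas (𝓡 n) ∞ M) {u : Model n} (hu : u ∈ φ.target)
    (hx : φ.symm u ∈ ψ.source) :
    logDensity V ψ (φ.symm u) =
      logDet (fderiv ℝ (ψ ∘ φ.symm) u) + logDensity V φ (φ.symm u) := by
  obtain ⟨l, hl, hb⟩ := hV.exists_mem (φ.symm u)
  have h1 : l.base ∈ φ.source := hb ▸ φ.map_target hu
  have h2 : l.base ∈ ψ.source := hb ▸ hx
  rw [← hb, hV.logDensity_base hφ hl h1, hV.logDensity_base hψ hl h2,
    Frame₁.lin_change hφ hψ h1 h2, hb, φ.right_inv hu,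
    logDet_comp (det_fderiv_transition_ne_zero hφ hψ hu hx) (l.det_lin_ne_zero hφ h1)]

theorem det_smul_id (r : ℝ) : (r • ContinuousLinearMap.id ℝ (Model n)).det = r ^ n := by
  rw [ContinuousLinearMap.det, ContinuousLinearMap.toLinearMap_smul, LinearMap.det_smul]
  simp

/-- The coordinate frames of a chart `c` are tangent to the volume `V` at the origin of `c` exactly
when the density of `V` with respect to `c` is stationary there. -/
theorem IsVolume.horizontal_tangent_iff (hV : IsVolume V) (c : CenteredChart n M)
    (hc : c.frame₁ ∈ V) :
    (∀ v : Model n, (v, (0 : Model n →L[ℝ] Model n)) ∈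
        tangentVectors c.chart V c.frame₁) ↔
      fderiv ℝ (logDensity V c.chart ∘ c.chart.symm) 0 = 0 := by
  have hH := hV.contDiffAt_logDensity c.mem_atlas c.zero_mem
  have hHd := (hH.differentiableAt (by simp)).hasFDerivAt
  have hH0 : logDensity V c.chart (c.chart.symm 0) = 0 := by
    have h := hV.logDensity_base c.mem_atlas hc c.origin_mem_source
    rwa [c.lin_frame₁_self, logDet_id] at h
  set H : Model n → ℝ := logDensity V c.chart ∘ c.chart.symm with hHdef
  constructor
  · intro h
    ext1 v
    obtain ⟨γ, hγ0, hγ, hγs, hγd⟩ := h v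
    have hd := (hγs.differentiableAt (by simp)).hasDerivAt
    rw [hγd] at hd
    have hfst : HasDerivAt (fun t => c.chart (γ t).base) v 0 := by
      simpa using hd.hasFDerivAt.fst.hasDerivAt
    have hsnd : HasDerivAt (fun t => (γ t).lin c.chart) 0 0 := by
      simpa using hd.hasFDerivAt.snd.hasDerivAt
    have h0 : c.chart (γ 0).base = 0 := by rw [hγ0]; exact c.chart_origin
    have h0' : (γ 0).lin c.chart = ContinuousLinearMap.id ℝ (Model n) := by
      rw [hγ0, c.lin_frame₁_self]
    have hL := (contDiffAt_logDet (A := ContinuousLinearMap.id ℝ (Model n))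
      (by rw [det_id]; exact one_ne_zero)).differentiableAt (by simp)
    have e1 := hHd.comp_hasDerivAt_of_eq 0 hfst h0.symm
    have e2 := hL.hasFDerivAt.comp_hasDerivAt_of_eq 0 hsnd h0'.symm
    have hev : (H ∘ fun t => c.chart (γ t).base) =ᶠ[𝓝 0]
        logDet ∘ fun t => (γ t).lin c.chart := by
      filter_upwards [hγ] with t ht
      simp only [hHdef, Function.comp_apply, c.chart.left_inv ht.2]
      exact hV.logDensity_base c.mem_atlas ht.1 ht.2
    simpa using (e1.congr_of_eventuallyEq hev.symm).unique e2
  · intro h v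
    -- The curve is `t ↦ (t v, A t)` with the multiple `A t` of the identity in `V`.
    let A : ℝ → Model n →L[ℝ] Model n := fun t =>
      Real.exp (H (t • v) / n) • ContinuousLinearMap.id ℝ (Model n)
    have hAdet : ∀ t, (A t).det ≠ 0 := fun t => by
      rw [det_smul_id]; exact pow_ne_zero _ (Real.exp_ne_zero _)
    have hAlog : ∀ t, logDet (A t) = H (t • v) := fun t => by
      rw [logDet, det_smul_id, Real.log_pow, Real.log_exp]
      rcases Nat.eq_zero_or_pos n with rfl | hn
      -- In dimension `0` the division by `n` is void, but there is only one vector.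
      · rw [Subsingleton.elim (t • v) 0, Nat.cast_zero, zero_mul]
        exact hH0.symm
      · field_simp
    have hl : HasDerivAt (fun t : ℝ => t • v) v 0 := by
      simpa using (hasDerivAt_id (0 : ℝ)).smul_const v
    have hls : ContDiffAt ℝ ∞ (fun t : ℝ => t • v) 0 := contDiffAt_id.smul contDiffAt_const
    have hAs : ContDiffAt ℝ ∞ A 0 := by
      refine ContDiffAt.smul (ContDiffAt.exp (ContDiffAt.div_const ?_ _)) contDiffAt_const
      exact ContDiffAt.comp (g := H) 0 (by rwa [zero_smul]) hls
    have hAd : HasDerivAt A 0 0 := by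
      have h1 := hHd.comp_hasDerivAt_of_eq 0 hl (zero_smul ℝ v).symm
      rw [h] at h1
      have h2 := ((h1.div_const (n : ℝ)).exp).smul_const (ContinuousLinearMap.id ℝ (Model n))
      refine h2.congr_deriv ?_
      ext1 w
      simp
    have hex : ∀ t : ℝ, ∃ l : Frame₁ n M, t • v ∈ c.chart.target →
        l.base = c.chart.symm (t • v) ∧ l.lin c.chart = A t := by
      intro t
      by_cases ht : t • v ∈ c.chart.target
      · obtain ⟨a, ha⟩ := exists_G1_of_det_ne_zero (hAdet t)
        obtain ⟨l, h1, h2⟩ := Frame₁.exists_coord c.mem_atlas (c.chart.map_target ht) a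
        exact ⟨l, fun _ => ⟨h1, h2.trans ha⟩⟩
      · exact ⟨c.frame₁, fun h' => absurd h' ht⟩
    choose γ hγ using hex
    have htarget : ∀ᶠ t : ℝ in 𝓝 0, t • v ∈ c.chart.target :=
      hls.continuousAt.eventually
        (c.chart.open_target.eventually_mem (by simpa using c.zero_mem))
    have hev : (fun t => (c.chart (γ t).base, (γ t).lin c.chart)) =ᶠ[𝓝 0]
        fun t => (t • v, A t) := by
      filter_upwards [htarget] with t ht
      rw [(hγ t ht).1, (hγ t ht).2, c.chart.right_inv ht]
    refine ⟨γ, ?_, ?_, (hls.prodMk hAs).congr_of_eventuallyEq hev, ?_⟩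
    · obtain ⟨h1, h2⟩ := hγ 0 (by rw [zero_smul]; exact c.zero_mem)
      rw [zero_smul] at h1
      refine (Frame₁.ext_lin (l := c.frame₁) c.mem_atlas c.origin_mem_source h1.symm ?_).symm
      rw [h2, c.lin_frame₁_self]
      simp only [A, zero_smul]
      rw [show H 0 = 0 from hH0]
      simp
    · filter_upwards [htarget] with t ht
      have hs : (γ t).base ∈ c.chart.source := by
        rw [(hγ t ht).1]; exact c.chart.map_target ht
      refine ⟨(hV.mem_iff c.mem_atlas hs).2 ?_, hs⟩
      rw [(hγ t ht).1, (hγ t ht).2, hAlog]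
      rfl
    · rw [hev.deriv_eq]
      exact (hl.prodMk hAd).deriv

/-- The set `V²` in the coordinates induced by a chart `ψ`: a 2-frame with coordinates `(A, B)`
over a frame in `V` belongs to `V²` iff the logarithmic density `H` of `V` satisfies
`dH (A v) = tr (A⁻¹ B(v, ·))`; the right hand side is the differential of `log |det|` at `A` in the
direction `B(v, ·)`. -/
theorem IsVolume.mem_prolongation_iff (hV : IsVolume V)
    (hψ : ψ ∈ IsManifold.maximalAtlas (𝓡 n) ∞ M) {z : Frame₂ n M} (hz : z.base ∈ ψ.source) :
    z ∈ prolongation V ↔ z.proj ∈ V ∧ ∀ v,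
      fderiv ℝ (logDensity V ψ ∘ ψ.symm) (ψ z.base) (z.proj.lin ψ v) =
        fderiv ℝ logDet (z.proj.lin ψ) (z.quad ψ v) := by
  -- Differentiate `H_ψ ∘ f = log |det Df| + H_c`, where `f = ψ ∘ c⁻¹`, at the origin.
  have key : ∀ c : CenteredChart n M, c.frame₂ = z →
      (fderiv ℝ (logDensity V c.chart ∘ c.chart.symm) 0 = 0 ↔ ∀ v,
        fderiv ℝ (logDensity V ψ ∘ ψ.symm) (ψ z.base) (z.proj.lin ψ v) =
          fderiv ℝ logDet (z.proj.lin ψ) (z.quad ψ v)) := by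
    rintro c rfl
    change c.origin ∈ ψ.source at hz
    have hf := c.contDiffAt_comp_symm hψ hz
    have hfd := (hf.differentiableAt (by simp)).hasFDerivAt
    have hffd := ((hf.fderiv_right (m := 1) (by norm_cast)).differentiableAt
      one_ne_zero).hasFDerivAt
    have hψH := ((hV.contDiffAt_logDensity hψ (ψ.map_source hz)).differentiableAt
      (by simp)).hasFDerivAt
    have hcH := ((hV.contDiffAt_logDensity c.mem_atlas c.zero_mem).differentiableAt
      (by simp)).hasFDerivAt
    have hL := ((contDiffAt_logDet (det_fderiv_transition_ne_zero c.mem_atlas hψ c.zero_mem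
      hz)).differentiableAt (by simp)).hasFDerivAt
    have hev : (logDensity V ψ ∘ ψ.symm) ∘ (ψ ∘ c.chart.symm) =ᶠ[𝓝 0]
        fun u => (logDet ∘ fderiv ℝ (ψ ∘ c.chart.symm)) u +
          (logDensity V c.chart ∘ c.chart.symm) u := by
      filter_upwards [eventually_symm_mem_source c.zero_mem hz] with u hu
      simp only [Function.comp_apply, ψ.left_inv hu.2]
      exact hV.logDensity_change c.mem_atlas hψ hu.1 hu.2
    have h1 : HasFDerivAt ((logDensity V ψ ∘ ψ.symm) ∘ (ψ ∘ c.chart.symm)) _ 0 :=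
      HasFDerivAt.comp (g := logDensity V ψ ∘ ψ.symm) 0 hψH hfd
    have h2 := ((hL.comp 0 hffd).add hcH).congr_of_eventuallyEq hev
    have h3 := h1.unique h2
    change _ ↔ ∀ v, fderiv ℝ (logDensity V ψ ∘ ψ.symm) (ψ c.origin) (c.frame₁.lin ψ v) =
          fderiv ℝ logDet (c.frame₁.lin ψ) (c.frame₂.quad ψ v)
    rw [c.lin_frame₁ hψ hz, c.quad_frame₂ hψ hz]
    constructor
    · intro h v
      rw [h, add_zero] at h3
      exact DFunLike.congr_fun h3 v
    · intro h
      ext1 v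
      have h4 := DFunLike.congr_fun h3 v
      exact left_eq_add.1 ((h v).symm.trans h4)
  constructor
  · rintro ⟨hp, c, rfl, h⟩
    exact ⟨hp, (key c rfl).1 ((hV.horizontal_tangent_iff c hp).1 h)⟩
  · rintro ⟨hp, h⟩
    obtain ⟨c, rfl⟩ := z.exists_rep
    exact ⟨hp, c, rfl, (hV.horizontal_tangent_iff c hp).2 ((key c rfl).2 h)⟩

end Volume

/-! ### Projective structures and parallel volumes -/

section Parallel

variable {n : ℕ} {M : Type*} [TopologicalSpace M] [ChartedSpace (Model n) M]
  {V : Set (Frame₁ n M)} {Q : Set (Frame₂ n M)}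

/-- The bilinear map `(u, v) ↦ μ(v) u + μ(u) v`, written so that it is visibly smooth in `μ`. -/
noncomputable def projBilin (μ : Model n →L[ℝ] ℝ) : Model n →L[ℝ] Model n →L[ℝ] Model n :=
  (μ.smulRight (ContinuousLinearMap.id ℝ (Model n))).flip +
    μ.smulRight (ContinuousLinearMap.id ℝ (Model n))

theorem projBilin_apply (μ : Model n →L[ℝ] ℝ) (u v : Model n) :
    projBilin μ u v = μ v • u + μ u • v := rfl

/-- The element of `𝔭` given by the covector `μ`. -/
noncomputable def projS2 (μ : Model n →L[ℝ] ℝ) : S2 n :=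
  ⟨projBilin μ, fun u v => by rw [projBilin_apply, projBilin_apply, add_comm]⟩

theorem projS2_mem (μ : Model n →L[ℝ] ℝ) : projS2 μ ∈ projectivePart n := ⟨μ, fun _ _ => rfl⟩

theorem mem_linearSubgroup_iff {H : Subgroup (G1 n)} {g : G2 n} :
    g ∈ linearSubgroup H ↔ g.lin ∈ H ∧ g.quad = 0 := Iff.rfl

theorem mem_projectiveSubgroup_iff {g : G2 n} :
    g ∈ projectiveSubgroup n ↔ g.quad ∈ projectivePart n :=
  ⟨fun h => h.2, fun h => ⟨Subgroup.mem_top _, h⟩⟩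

theorem linearSubgroup_le_projectiveSubgroup (H : Subgroup (G1 n)) :
    linearSubgroup H ≤ projectiveSubgroup n := fun g hg =>
  mem_projectiveSubgroup_iff.2 (by rw [hg.2]; exact (projectivePart n).zero_mem)

theorem linearSubgroup_mono {H K : Subgroup (G1 n)} (h : H ≤ K) :
    linearSubgroup H ≤ linearSubgroup K := fun _ hg => ⟨h hg.1, hg.2⟩

/-- The second order coordinate, over the frame `A`, of the 2-frame in `V²` that is projectively
equivalent to the 2-frame with coordinates `(A₀, B₀)`, where `δ` is the differential of the
logarithmic density of `V`: first the 2-frame is translated by `A₀⁻¹ A`, then by the element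
of `𝔭` whose covector is dictated by `mem_prolongation_iff`. -/
noncomputable def parallelQuad (A₀ : Model n →L[ℝ] Model n)
    (B₀ : Model n →L[ℝ] Model n →L[ℝ] Model n) (A : Model n →L[ℝ] Model n)
    (δ : Model n →L[ℝ] ℝ) : Model n →L[ℝ] Model n →L[ℝ] Model n :=
  B₀.bilinearComp (A₀.inverse.comp A) (A₀.inverse.comp A) +
    (ContinuousLinearMap.compL ℝ (Model n) (Model n) (Model n) A).comp
      (projBilin (((n : ℝ) + 1)⁻¹ • (δ.comp A - (fderiv ℝ logDet A).comp
        (B₀.bilinearComp (A₀.inverse.comp A) (A₀.inverse.comp A)))))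

theorem contDiff_flip {E F G : Type*} [NormedAddCommGroup E] [NormedSpace ℝ E]
    [NormedAddCommGroup F] [NormedSpace ℝ F] [NormedAddCommGroup G] [NormedSpace ℝ G] :
    ContDiff ℝ ∞ fun T : E →L[ℝ] F →L[ℝ] G => T.flip :=
  LinearIsometryEquiv.contDiff (𝕜 := ℝ) (E := E →L[ℝ] F →L[ℝ] G) (F := F →L[ℝ] E →L[ℝ] G)
    (ContinuousLinearMap.flipₗᵢ ℝ E F G)

theorem contDiff_bilinearComp {E F : Type*} [NormedAddCommGroup E] [NormedSpace ℝ E]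
    [NormedAddCommGroup F] [NormedSpace ℝ F] :
    ContDiff ℝ ∞ fun p : (E →L[ℝ] E →L[ℝ] F) × (E →L[ℝ] E) => p.1.bilinearComp p.2 p.2 :=
  contDiff_flip.comp ((contDiff_flip.comp (contDiff_fst.clm_comp contDiff_snd)).clm_comp
    contDiff_snd)

theorem contDiff_compL_comp {E F G : Type*} [NormedAddCommGroup E] [NormedSpace ℝ E]
    [NormedAddCommGroup F] [NormedSpace ℝ F] [NormedAddCommGroup G] [NormedSpace ℝ G] :
    ContDiff ℝ ∞ fun p : (F →L[ℝ] G) × (E →L[ℝ] E →L[ℝ] F) =>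
      (ContinuousLinearMap.compL ℝ E F G p.1).comp p.2 := by
  have h : ContDiff ℝ ∞ (ContinuousLinearMap.compL ℝ E F G) :=
    ContinuousLinearMap.contDiff (𝕜 := ℝ) (E := F →L[ℝ] G)
      (F := (E →L[ℝ] F) →L[ℝ] E →L[ℝ] G) (ContinuousLinearMap.compL ℝ E F G)
  exact (h.comp contDiff_fst).clm_comp contDiff_snd

theorem contDiff_projBilin : ContDiff ℝ ∞ (projBilin (n := n)) := by
  have h : ContDiff ℝ ∞ fun μ : Model n →L[ℝ] ℝ =>
      μ.smulRight (ContinuousLinearMap.id ℝ (Model n)) :=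
    ContDiff.smulRight contDiff_id contDiff_const
  exact ContDiff.add (contDiff_flip.comp h) h

theorem contDiffAt_parallelQuad {A₀ A : Model n →L[ℝ] Model n} (hA₀ : A₀.det ≠ 0)
    (hA : A.det ≠ 0) (B₀ : Model n →L[ℝ] Model n →L[ℝ] Model n) (δ : Model n →L[ℝ] ℝ) :
    ContDiffAt ℝ ∞ (fun p : ((Model n →L[ℝ] Model n) × (Model n →L[ℝ] Model n →L[ℝ] Model n)) ×
      ((Model n →L[ℝ] Model n) × (Model n →L[ℝ] ℝ)) =>
        parallelQuad p.1.1 p.1.2 p.2.1 p.2.2) ((A₀, B₀), (A, δ)) := by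
  obtain ⟨a, rfl⟩ := exists_G1_of_det_ne_zero hA₀
  have h11 : ContDiffAt ℝ ∞ (fun p : ((Model n →L[ℝ] Model n) ×
      (Model n →L[ℝ] Model n →L[ℝ] Model n)) × ((Model n →L[ℝ] Model n) × (Model n →L[ℝ] ℝ)) =>
        p.1.1) (((a : Model n →L[ℝ] Model n), B₀), (A, δ)) := contDiffAt_fst.fst
  have h12 : ContDiffAt ℝ ∞ (fun p : ((Model n →L[ℝ] Model n) ×
      (Model n →L[ℝ] Model n →L[ℝ] Model n)) × ((Model n →L[ℝ] Model n) × (Model n →L[ℝ] ℝ)) =>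
        p.1.2) (((a : Model n →L[ℝ] Model n), B₀), (A, δ)) := contDiffAt_fst.snd
  have h21 : ContDiffAt ℝ ∞ (fun p : ((Model n →L[ℝ] Model n) ×
      (Model n →L[ℝ] Model n →L[ℝ] Model n)) × ((Model n →L[ℝ] Model n) × (Model n →L[ℝ] ℝ)) =>
        p.2.1) (((a : Model n →L[ℝ] Model n), B₀), (A, δ)) := contDiffAt_snd.fst
  have h22 : ContDiffAt ℝ ∞ (fun p : ((Model n →L[ℝ] Model n) ×
      (Model n →L[ℝ] Model n →L[ℝ] Model n)) × ((Model n →L[ℝ] Model n) × (Model n →L[ℝ] ℝ)) =>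
        p.2.2) (((a : Model n →L[ℝ] Model n), B₀), (A, δ)) := contDiffAt_snd.snd
  have hT := (ContDiffAt.comp (g := ContinuousLinearMap.inverse)
    (((a : Model n →L[ℝ] Model n), B₀), (A, δ))
    (contDiffAt_map_inverse (n := ∞) a) h11).clm_comp h21
  have hB := contDiff_bilinearComp.contDiffAt.comp _ (h12.prodMk hT)
  have hL : ContDiffAt ℝ ∞ (fderiv ℝ (logDet (n := n))) A :=
    (contDiffAt_logDet hA).fderiv_right (by norm_cast)
  have hL' := ContDiffAt.comp (g := fderiv ℝ (logDet (n := n)))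
    (((a : Model n →L[ℝ] Model n), B₀), (A, δ)) hL h21
  have hμ := ((h22.clm_comp h21).sub (hL'.clm_comp hB)).const_smul ((n : ℝ) + 1)⁻¹
  exact hB.add (contDiff_compL_comp.contDiffAt.comp _
    (h21.prodMk (contDiff_projBilin.contDiffAt.comp _ hμ)))

variable [IsManifold (𝓡 n) ∞ M] {ψ : OpenPartialHomeomorph M (Model n)}

/-- Smoothness of a section of `F²M` may be tested in a single chart. -/
theorem isSmoothSection₂_of_chart (hψ : ψ ∈ IsManifold.maximalAtlas (𝓡 n) ∞ M) {U : Set M}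
    (hU : U ⊆ ψ.source) {σ : M → Frame₂ n M} (hσ : ∀ x ∈ U, (σ x).base = x)
    (hlin : ContMDiffOn (𝓡 n) 𝓘(ℝ, Model n →L[ℝ] Model n) ∞ (fun x => (σ x).proj.lin ψ) U)
    (hquad : ContMDiffOn (𝓡 n) 𝓘(ℝ, Model n →L[ℝ] Model n →L[ℝ] Model n) ∞
      (fun x => (σ x).quad ψ) U) : IsSmoothSection₂ U σ := by
  refine ⟨hσ, fun χ hχ => ?_⟩
  have hT : ∀ x ∈ U ∩ χ.source, ContDiffAt ℝ ∞ (χ ∘ ψ.symm) (ψ x) := fun x hx =>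
    contDiffAt_transition hψ hχ (ψ.map_source (hU hx.1))
      (by rw [ψ.left_inv (hU hx.1)]; exact hx.2)
  have hψs : ContMDiffOn (𝓡 n) (𝓡 n) ∞ ψ (U ∩ χ.source) :=
    (contMDiffOn_of_mem_maximalAtlas hψ).mono (Set.inter_subset_left.trans hU)
  have hD1 : ContMDiffOn (𝓡 n) 𝓘(ℝ, Model n →L[ℝ] Model n) ∞
      (fun x => fderiv ℝ (χ ∘ ψ.symm) (ψ x)) (U ∩ χ.source) := fun x hx =>
    ContMDiffAt.comp_contMDiffWithinAt (g := fderiv ℝ (χ ∘ ψ.symm)) x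
      ((hT x hx).fderiv_right (m := ∞) (by norm_cast)).contMDiffAt (hψs x hx)
  have hD2 : ContMDiffOn (𝓡 n) 𝓘(ℝ, Model n →L[ℝ] Model n →L[ℝ] Model n) ∞
      (fun x => fderiv ℝ (fderiv ℝ (χ ∘ ψ.symm)) (ψ x)) (U ∩ χ.source) := fun x hx =>
    ContMDiffAt.comp_contMDiffWithinAt (g := fderiv ℝ (fderiv ℝ (χ ∘ ψ.symm))) x
      (((hT x hx).fderiv_right (m := ∞) (by norm_cast)).fderiv_right
        (m := ∞) (by norm_cast)).contMDiffAt (hψs x hx)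
  have hlin' := hlin.mono (Set.inter_subset_left (t := χ.source))
  have hquad' := hquad.mono (Set.inter_subset_left (t := χ.source))
  constructor
  · refine (hD1.clm_comp hlin').congr fun x hx => ?_
    have hb := hσ x hx.1
    have h1 := Frame₁.lin_change (l := (σ x).proj) hψ hχ (hb.symm ▸ hU hx.1 : (σ x).base ∈ _)
      (hb.symm ▸ hx.2 : (σ x).base ∈ _)
    rwa [show (σ x).proj.base = x from hb] at h1
  · have h1 := contDiff_bilinearComp.contMDiff.comp_contMDiffOn (hD2.prodMk_space hlin')
    have h2 := contDiff_compL_comp.contMDiff.comp_contMDiffOn (hD1.prodMk_space hquad')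
    refine (h1.add h2).congr fun x hx => ?_
    have hb := hσ x hx.1
    ext1 u
    ext1 v
    rw [Frame₂.quad_change hψ hχ (hb.symm ▸ hU hx.1) (hb.symm ▸ hx.2), hb]
    rfl

theorem IsVolume.mem_prolongation_of_translate (hV : IsVolume V) {z z' : Frame₂ n M} {g : G2 n}
    (hz : z ∈ prolongation V) (hg : g ∈ linearSubgroup (SLpm n)) (h : IsTranslate₂ z g z') :
    z' ∈ prolongation V := by
  have hψ := IsManifold.chart_mem_maximalAtlas (I := 𝓡 n) (n := ∞) z.base
  have hx := mem_chart_source (Model n) z.base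
  obtain ⟨hb, hl, hq⟩ := (isTranslate₂_iff hψ hx g).1 h
  rw [hV.mem_prolongation_iff hψ hx] at hz
  rw [hV.mem_prolongation_iff hψ (hb.symm ▸ hx)]
  refine ⟨hV.stable _ hz.1 g.lin hg.1 _ h.proj, fun v => ?_⟩
  have hq' : z'.quad (chartAt (Model n) z.base) v =
      (z.quad (chartAt (Model n) z.base) (g.lin v)).comp (g.lin : Model n →L[ℝ] Model n) := by
    ext1 w
    rw [hq, show g.quad = 0 from hg.2]
    simp
  rw [hq', hl, hb]
  exact (hz.2 (g.lin v)).trans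
    (fderiv_logDet_comp 1 g.lin (z.proj.det_lin_ne_zero hψ hx) _).symm

/-- Translating by the element of `𝔭` with covector `μ` changes the trace in
`mem_prolongation_iff` by `(n + 1) μ`. -/
theorem IsVolume.projective_translate_mem_prolongation_iff (hV : IsVolume V)
    (hψ : ψ ∈ IsManifold.maximalAtlas (𝓡 n) ∞ M) {z z' : Frame₂ n M} (hx : z.base ∈ ψ.source)
    (hp : z.proj ∈ V) {μ : Model n →L[ℝ] ℝ} (h : IsTranslate₂ z ⟨1, projS2 μ⟩ z') :
    z' ∈ prolongation V ↔ ∀ v,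
      fderiv ℝ (logDensity V ψ ∘ ψ.symm) (ψ z.base) (z.proj.lin ψ v) =
        fderiv ℝ logDet (z.proj.lin ψ) (z.quad ψ v) + (n + 1) * μ v := by
  obtain ⟨hb, hl, hq⟩ := (isTranslate₂_iff hψ hx _).1 h
  have hpp : z'.proj ∈ V := hV.stable _ hp 1 (SLpm n).one_mem _ h.proj
  replace hl : z'.proj.lin ψ = z.proj.lin ψ := hl
  obtain ⟨a, ha⟩ := z.proj.exists_lin_eq hψ hx
  rw [hV.mem_prolongation_iff hψ (hb.symm ▸ hx), and_iff_right hpp, hl, hb]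
  refine forall_congr' fun v => ?_
  have hq' : z'.quad ψ v = z.quad ψ v +
      ((a : Model n →L[ℝ] Model n).comp
        (μ v • ContinuousLinearMap.id ℝ (Model n) + μ.smulRight v)).comp
          ((1 : G1 n) : Model n →L[ℝ] Model n) := by
    ext1 w
    rw [hq, ← ha, add_comm (μ v • _)]
    rfl
  -- The differential at `A` is pulled back to the identity, where the trace is known.
  have h1 := fderiv_logDet_comp a 1 (X := ContinuousLinearMap.id ℝ (Model n))
    (by rw [det_id]; exact one_ne_zero)
    (μ v • ContinuousLinearMap.id ℝ (Model n) + μ.smulRight v)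
  rw [fderiv_logDet_projective] at h1
  rw [hq', map_add, ← h1, ← ha]
  rfl

/-- Two projectively equivalent elements of `V²` over the same point differ by an element of
`SL^±ₙ`. -/
theorem IsVolume.mem_linearSubgroup (hV : IsVolume V) {z z' : Frame₂ n M}
    (hz : z ∈ prolongation V) (hz' : z' ∈ prolongation V) {g : G2 n}
    (hg : g ∈ projectiveSubgroup n) (h : IsTranslate₂ z g z') : g ∈ linearSubgroup (SLpm n) := by
  have ha : g.lin ∈ SLpm n := hV.mem_SLpm hz.1 hz'.1 h.proj
  obtain ⟨μ, hμ⟩ := hg.2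
  have hs : g.quad = projS2 μ := S2.ext' hμ
  obtain ⟨z₁, h₁⟩ := exists_isTranslate₂ z ⟨g.lin, 0⟩
  have hz₁ := hV.mem_prolongation_of_translate hz
    (g := ⟨g.lin, 0⟩) (mem_linearSubgroup_iff.2 ⟨ha, rfl⟩) h₁
  have h₂ := h₁.symm.trans h
  -- After matching the 1-frames, only the `𝔭`-part of `g` is left.
  have hmul : (⟨g.lin, 0⟩ : G2 n)⁻¹ * g = ⟨1, projS2 μ⟩ := by
    rw [inv_mul_eq_iff_eq_mul]
    ext1
    · simp
    · simp [S2.zero_conj, hs]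
  rw [hmul] at h₂
  have hψ := IsManifold.chart_mem_maximalAtlas (I := 𝓡 n) (n := ∞) z₁.base
  have hx := mem_chart_source (Model n) z₁.base
  have e1 := ((hV.mem_prolongation_iff hψ hx).1 hz₁).2
  have e2 := (hV.projective_translate_mem_prolongation_iff hψ hx hz₁.1 h₂).1 hz'
  have hμ0 : ∀ v, μ v = 0 := fun v => by
    have h3 := e2 v
    rw [e1 v, left_eq_add] at h3
    exact (mul_eq_zero.1 h3).resolve_left (by positivity)
  refine mem_linearSubgroup_iff.2 ⟨ha, S2.ext' fun u v => ?_⟩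
  rw [hμ, hμ0, hμ0]
  simp

/-- Over every frame of `V`, the projective structure contains an element of `V²`. -/
theorem IsVolume.exists_mem_prolongation (hV : IsVolume V) (hQ : IsProjectiveStructure Q)
    (hψ : ψ ∈ IsManifold.maximalAtlas (𝓡 n) ∞ M) {y : Frame₂ n M} (hy : y ∈ Q)
    {l : Frame₁ n M} (hl : l ∈ V) (hb : y.base = l.base) (hx : y.base ∈ ψ.source) :
    ∃ z ∈ Q ∩ prolongation V, z.proj = l ∧
      z.quad ψ = parallelQuad (y.proj.lin ψ) (y.quad ψ) (l.lin ψ)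
        (fderiv ℝ (logDensity V ψ ∘ ψ.symm) (ψ y.base)) := by
  obtain ⟨a, ha⟩ := exists_isTranslate₁_of_base_eq (l := y.proj) hb
  obtain ⟨y₁, h₁⟩ := exists_isTranslate₂ y ⟨a, 0⟩
  have hy₁Q : y₁ ∈ Q := hQ.stable y hy _
    (mem_projectiveSubgroup_iff.2 (projectivePart n).zero_mem) y₁ h₁
  have hp : y₁.proj = l := h₁.proj.unique ha
  obtain ⟨hb₁, -, hq₁⟩ := (isTranslate₂_iff hψ hx _).1 h₁
  have hx₁ : y₁.base ∈ ψ.source := hb₁.symm ▸ hx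
  have hinv : (y.proj.lin ψ).inverse.comp (l.lin ψ) = (a : Model n →L[ℝ] Model n) := by
    obtain ⟨e, he⟩ := y.proj.exists_lin_eq hψ hx
    rw [((isTranslate₁_iff hψ hx a).1 ha).2, ← he, ContinuousLinearMap.inverse_equiv]
    ext1 w
    exact e.symm_apply_apply _
  set δ := fderiv ℝ (logDensity V ψ ∘ ψ.symm) (ψ y.base) with hδ
  have hB₁ : y₁.quad ψ = (y.quad ψ).bilinearComp ((y.proj.lin ψ).inverse.comp (l.lin ψ))
      ((y.proj.lin ψ).inverse.comp (l.lin ψ)) := by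
    rw [hinv]
    ext1 u
    ext1 v
    rw [hq₁]
    simp
  let μ : Model n →L[ℝ] ℝ := ((n : ℝ) + 1)⁻¹ •
    (δ.comp (l.lin ψ) - (fderiv ℝ logDet (l.lin ψ)).comp (y₁.quad ψ))
  obtain ⟨z, h⟩ := exists_isTranslate₂ y₁ ⟨1, projS2 μ⟩
  obtain ⟨hbz, hlz, hqz⟩ := (isTranslate₂_iff hψ hx₁ _).1 h
  refine ⟨z, ⟨hQ.stable y₁ hy₁Q _ (mem_projectiveSubgroup_iff.2 (projS2_mem μ)) z h, ?_⟩, ?_, ?_⟩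
  · rw [hV.projective_translate_mem_prolongation_iff hψ hx₁ (hp ▸ hl) h, hb₁, hp, ← hδ]
    intro v
    have hn : (n : ℝ) + 1 ≠ 0 := by positivity
    have hμv : μ v = ((n : ℝ) + 1)⁻¹ *
        (δ (l.lin ψ v) - fderiv ℝ logDet (l.lin ψ) (y₁.quad ψ v)) := rfl
    rw [hμv, mul_inv_cancel_left₀ hn]
    ring
  · rw [← hp]
    exact Frame₁.ext_lin hψ (hbz.symm ▸ hx₁ : z.base ∈ _) hbz hlz
  · rw [parallelQuad, ← hB₁]
    ext1 u
    ext1 v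
    rw [hqz, hp]
    rfl

/-- `Q ∩ V²` has smooth local sections. -/
theorem IsVolume.exists_local_section (hV : IsVolume V) (hQ : IsProjectiveStructure Q) (x : M) :
    ∃ U : Set M, IsOpen U ∧ x ∈ U ∧
      ∃ σ : M → Frame₂ n M, IsSmoothSection₂ U σ ∧ ∀ y ∈ U, σ y ∈ Q ∩ prolongation V := by
  obtain ⟨U₁, hU₁, hx₁, σ₁, hσ₁, hσV⟩ := hV.local_section x
  obtain ⟨U₂, hU₂, hx₂, σ₂, hσ₂, hσQ⟩ := hQ.local_section x
  have hψ := IsManifold.chart_mem_maximalAtlas (I := 𝓡 n) (n := ∞) x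
  set ψ := chartAt (Model n) x with hψdef
  have hex : ∀ y, ∃ z : Frame₂ n M, y ∈ U₁ ∩ U₂ ∩ ψ.source →
      z ∈ Q ∩ prolongation V ∧ z.proj = σ₁ y ∧
        z.quad ψ = parallelQuad ((σ₂ y).proj.lin ψ) ((σ₂ y).quad ψ) ((σ₁ y).lin ψ)
          (fderiv ℝ (logDensity V ψ ∘ ψ.symm) (ψ y)) := by
    intro y
    by_cases hy : y ∈ U₁ ∩ U₂ ∩ ψ.source
    · have hb₁ := hσ₁.1 y hy.1.1
      have hb₂ := hσ₂.1 y hy.1.2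
      obtain ⟨z, hz, hzp, hzq⟩ := hV.exists_mem_prolongation hQ hψ (hσQ y hy.1.2)
        (hσV y hy.1.1) (hb₂.trans hb₁.symm) (hb₂.symm ▸ hy.2)
      rw [hb₂] at hzq
      exact ⟨z, fun _ => ⟨hz, hzp, hzq⟩⟩
    · exact ⟨σ₂ x, fun h => absurd h hy⟩
  choose σ hσ using hex
  refine ⟨U₁ ∩ U₂ ∩ ψ.source, (hU₁.inter hU₂).inter ψ.open_source,
    ⟨⟨hx₁, hx₂⟩, mem_chart_source _ x⟩, σ, ?_, fun y hy => (hσ y hy).1⟩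
  have hA : ContMDiffOn (𝓡 n) 𝓘(ℝ, Model n →L[ℝ] Model n) ∞ (fun y => (σ₁ y).lin ψ)
      (U₁ ∩ U₂ ∩ ψ.source) := (hσ₁.2 ψ hψ).mono fun y hy => ⟨hy.1.1, hy.2⟩
  have hA₀ : ContMDiffOn (𝓡 n) 𝓘(ℝ, Model n →L[ℝ] Model n) ∞ (fun y => (σ₂ y).proj.lin ψ)
      (U₁ ∩ U₂ ∩ ψ.source) := (hσ₂.2 ψ hψ).1.mono fun y hy => ⟨hy.1.2, hy.2⟩
  have hB₀ : ContMDiffOn (𝓡 n) 𝓘(ℝ, Model n →L[ℝ] Model n →L[ℝ] Model n) ∞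
      (fun y => (σ₂ y).quad ψ) (U₁ ∩ U₂ ∩ ψ.source) :=
    (hσ₂.2 ψ hψ).2.mono fun y hy => ⟨hy.1.2, hy.2⟩
  have hδ : ContMDiffOn (𝓡 n) 𝓘(ℝ, Model n →L[ℝ] ℝ) ∞
      (fun y => fderiv ℝ (logDensity V ψ ∘ ψ.symm) (ψ y)) (U₁ ∩ U₂ ∩ ψ.source) := fun y hy =>
    ContMDiffAt.comp_contMDiffWithinAt (g := fderiv ℝ (logDensity V ψ ∘ ψ.symm)) y
      ((hV.contDiffAt_logDensity hψ (ψ.map_source hy.2)).fderiv_right (m := ∞)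
        (by norm_cast)).contMDiffAt
      ((contMDiffAt_of_mem_maximalAtlas hψ hy.2).contMDiffWithinAt)
  refine isSmoothSection₂_of_chart hψ Set.inter_subset_right
    (fun y hy => ?_) (hA.congr fun y hy => by rw [(hσ y hy).2.1]) ?_
  · change (σ y).proj.base = y
    rw [(hσ y hy).2.1]
    exact hσ₁.1 y hy.1.1
  · refine ContMDiffOn.congr (f := fun y => parallelQuad ((σ₂ y).proj.lin ψ) ((σ₂ y).quad ψ)
      ((σ₁ y).lin ψ) (fderiv ℝ (logDensity V ψ ∘ ψ.symm) (ψ y))) (fun y hy => ?_)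
      fun y hy => (hσ y hy).2.2
    have hb₁ : (σ₁ y).base ∈ ψ.source := (hσ₁.1 y hy.1.1).symm ▸ hy.2
    have hb₂ : (σ₂ y).base ∈ ψ.source := (hσ₂.1 y hy.1.2).symm ▸ hy.2
    exact ContMDiffAt.comp_contMDiffWithinAt y
      (contDiffAt_parallelQuad ((σ₂ y).proj.det_lin_ne_zero hψ hb₂)
        ((σ₁ y).det_lin_ne_zero hψ hb₁) ((σ₂ y).quad ψ) _).contMDiffAt
      (((hA₀ y hy).prodMk_space (hB₀ y hy)).prodMk_space ((hA y hy).prodMk_space (hδ y hy)))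

theorem IsVolume.isGStructure₂_inter_prolongation (hV : IsVolume V)
    (hQ : IsProjectiveStructure Q) :
    IsGStructure₂ (linearSubgroup (SLpm n)) (Q ∩ prolongation V) where
  stable z hz g hg z' h :=
    ⟨hQ.stable z hz.1 g (linearSubgroup_le_projectiveSubgroup _ hg) z' h,
      hV.mem_prolongation_of_translate hz.2 hg h⟩
  transitive z hz z' hz' hb := by
    obtain ⟨g, hg, h⟩ := hQ.transitive z hz.1 z' hz'.1 hb
    exact ⟨g, hV.mem_linearSubgroup hz.2 hz'.2 hg h, h⟩
  local_section := hV.exists_local_section hQ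

theorem subset_extension (G : Subgroup (G2 n)) (P : Set (Frame₂ n M)) : P ⊆ extension G P :=
  fun z hz => ⟨z, hz, 1, G.one_mem, isTranslate₂_one z⟩

/-- The extension of a reduction to a larger group is a reduction. -/
theorem IsGStructure₂.extension {G H : Subgroup (G2 n)} {P : Set (Frame₂ n M)}
    (hP : IsGStructure₂ H P) (hHG : H ≤ G) : IsGStructure₂ G (extension G P) where
  stable := by
    rintro z ⟨w, hw, k, hk, hwz⟩ g hg z' h
    exact ⟨w, hw, k * g, G.mul_mem hk hg, hwz.trans h⟩
  transitive := by
    rintro z ⟨w, hw, k, hk, hwz⟩ z' ⟨w', hw', k', hk', hwz'⟩ hb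
    rw [hwz.base_eq, hwz'.base_eq] at hb
    obtain ⟨g, hg, h⟩ := hP.transitive w hw w' hw' hb
    exact ⟨_, G.mul_mem (G.mul_mem (G.inv_mem hk) (hHG hg)) hk', (hwz.symm.trans h).trans hwz'⟩
  local_section x := by
    obtain ⟨U, hU, hx, σ, hσ, hσP⟩ := hP.local_section x
    exact ⟨U, hU, hx, σ, hσ, fun y hy => subset_extension G P (hσP y hy)⟩

theorem IsVolume.makesParallel_extension (hV : IsVolume V) :
    MakesParallel (extension (linearSubgroup ⊤) (Q ∩ prolongation V)) V := by
  rintro z ⟨w, hw, g, hg, h⟩ hz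
  exact hV.mem_prolongation_of_translate hw.2
    (mem_linearSubgroup_iff.2 ⟨hV.mem_SLpm hw.2.1 hz h.proj, hg.2⟩) h

theorem exists_mem_SLC_proj_eq {C : Set (Frame₂ n M)} (hC : IsSLC C) (l : Frame₁ n M) :
    ∃ z ∈ C, z.proj = l := by
  obtain ⟨U, -, hx, σ, hσ, hσC⟩ := hC.local_section l.base
  obtain ⟨a, ha⟩ := exists_isTranslate₁_of_base_eq (l := (σ l.base).proj) (l' := l)
    (hσ.1 _ hx)
  obtain ⟨z, h⟩ := exists_isTranslate₂ (σ l.base) ⟨a, 0⟩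
  exact ⟨z, hC.stable _ (hσC _ hx) _ (mem_linearSubgroup_iff.2 ⟨Subgroup.mem_top _, rfl⟩) z h,
    h.proj.unique ha⟩

/-- An SLC has at most one element over each 1-frame. -/
theorem eq_of_isTranslate₂_of_proj_eq {z z' : Frame₂ n M} {g : G2 n} (h : IsTranslate₂ z g z')
    (hg : g ∈ linearSubgroup ⊤) (hp : z.proj = z'.proj) : z = z' := by
  have hψ := IsManifold.chart_mem_maximalAtlas (I := 𝓡 n) (n := ∞) z.base
  have hx := mem_chart_source (Model n) z.base
  obtain ⟨-, hl, -⟩ := (isTranslate₂_iff hψ hx g).1 h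
  have h1 : (g.lin : Model n →L[ℝ] Model n) = ContinuousLinearMap.id ℝ (Model n) :=
    comp_left_cancel (z.proj.det_lin_ne_zero hψ hx) (by rw [← hl, ← hp]; rfl)
  have hg1 : g = 1 := by
    ext1
    · exact ContinuousLinearEquiv.ext (funext fun u => DFunLike.congr_fun h1 u)
    · exact hg.2
  rw [hg1] at h
  exact (isTranslate₂_one z).unique h

/-- Uniqueness: an SLC in `Q` that makes `V` parallel is the extension of `Q ∩ V²`. -/
theorem IsVolume.eq_extension (hV : IsVolume V) (hQ : IsProjectiveStructure Q)
    {C : Set (Frame₂ n M)} (hC : IsSLC C) (hCQ : C ⊆ Q) (hCV : MakesParallel C V) :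
    C = extension (linearSubgroup ⊤) (Q ∩ prolongation V) := by
  apply Set.Subset.antisymm
  · intro z hz
    obtain ⟨l, hl, hb⟩ := hV.exists_mem z.base
    obtain ⟨w, hw, hwl⟩ := exists_mem_SLC_proj_eq hC l
    obtain ⟨g, hg, h⟩ := hC.transitive w hw z hz
      (by rw [← hb, ← hwl]; rfl)
    exact ⟨w, ⟨hCQ hw, hCV w hw (hwl ▸ hl)⟩, g, hg, h⟩
  · rintro z ⟨w, hw, g, hg, h⟩
    refine hC.stable w ?_ g hg z h
    obtain ⟨y, hy, hyw⟩ := exists_mem_SLC_proj_eq hC w.proj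
    obtain ⟨k, hk, hyk⟩ := (hV.isGStructure₂_inter_prolongation hQ).transitive y
      ⟨hCQ hy, hCV y hy (hyw ▸ hw.2.1)⟩ w hw (congrArg Frame₁.base hyw)
    rwa [← eq_of_isTranslate₂_of_proj_eq hyk (linearSubgroup_mono le_top hk) hyw]

end Parallel

end HigherFrames

theorem theorem5 {n : ℕ} {M : Type*} [TopologicalSpace M]
    [ChartedSpace (HigherFrames.Model n) M] [IsManifold (𝓡 n) ∞ M]
    (Q : Set (HigherFrames.Frame₂ n M)) (hQ : HigherFrames.IsProjectiveStructure Q)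
    (V : Set (HigherFrames.Frame₁ n M)) (hV : HigherFrames.IsVolume V) :
    ∃ C : Set (HigherFrames.Frame₂ n M),
      (HigherFrames.IsSLC C ∧ C ⊆ Q ∧ HigherFrames.MakesParallel C V) ∧
      (∀ C' : Set (HigherFrames.Frame₂ n M),
        HigherFrames.IsSLC C' ∧ C' ⊆ Q ∧ HigherFrames.MakesParallel C' V → C' = C) ∧
      HigherFrames.IsGStructure₂ (HigherFrames.linearSubgroup (HigherFrames.SLpm n))
        (Q ∩ HigherFrames.prolongation V) ∧
      C = HigherFrames.extension (HigherFrames.linearSubgroup ⊤)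
        (Q ∩ HigherFrames.prolongation V) := by
  have hP := hV.isGStructure₂_inter_prolongation hQ
  refine ⟨_, ⟨hP.extension (HigherFrames.linearSubgroup_mono le_top), ?_,
    hV.makesParallel_extension⟩, fun C' hC' => hV.eq_extension hQ hC'.1 hC'.2.1 hC'.2.2, hP, rfl⟩
  rintro z ⟨w, hw, g, hg, h⟩
  exact hQ.stable w hw.1 g (HigherFrames.linearSubgroup_le_projectiveSubgroup _ hg) z h
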